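/- Let $k\ge 1$ and $n=2k+2$. The Schrijver graph $\mathrm{SG}(2k+2,k)$ has as vertices the $k$-element subsets of $\{1,\dots,2k+2\}$ that are independent in the cycle $C_{2k+2}$ with consecutive vertices $1,2,\dots,2k+2$; two such sets are adjacent if and only if they are disjoint. For $1\le j\le 2k+2$ let $$V_j=\{a\in\{1,\dots,2k+2\}\setminus\{j\} : a\equiv j \pmod 2\},$$ a vertex of $\mathrm{SG}(2k+2,k)$. Let $L_k$ be the graph obtained from the cycle $C_{2k+2}$ by adding the edges $\{i,i+k+1\}$, $1\le i\le k+1$, if $k$ is even, and the edges $\{i,i+k\}$, $1\le i\le k+1$, if $k$ is odd. Let $Y_k$ be the spanning subgraph of $\mathrm{SG}(2k+2,k)$ obtained by deleting exactly those edges $V_iV_j$ for which $ij$ is not an edge of $L_k$ (all edges of $\mathrm{SG}(2k+2,k)$ with an endpoint outside $\{V_1,\dots,V_{2k+2}\}$ are kept). Call an edge $e$ of a graph $G$ critical if $\chi(G\setminus\{e\})<\chi(G)$, and call $G$ edge-color-critical if all of its edges are critical. **Theorem.** For every $k\ge 4$ the graph $Y_k$ is edge-color-critical. In $Y_3$ all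 edges but two are critical; that is, exactly two edges of $Y_3$ are not critical. -/

import Mathlib

/-- The Kneser graph `KG(n,k)`: its vertices are the `k`-element subsets of an `n`-element set, and
two of them are adjacent when they are disjoint (`A ≠ B` matters only for `k = 0`). -/
def kneserGraph (n k : ℕ) : SimpleGraph {A : Finset (Fin n) // A.card = k} where
  Adj A B := A ≠ B ∧ Disjoint A.1 B.1
  symm := ⟨fun _ _ h => ⟨h.1.symm, h.2.symm⟩⟩
  loopless := ⟨fun _ h => h.1 rfl⟩

/-- The vertices of the Schrijver graph: those `k`-subsets of the vertex set of the cycle `C_n`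
that are independent in `C_n`. -/
def schrijverVertices (n k : ℕ) : Set {A : Finset (Fin n) // A.card = k} :=
  {A | (SimpleGraph.cycleGraph n).IsIndepSet (A.1 : Set (Fin n))}

/-- The Schrijver graph `SG(n,k)`, an induced subgraph of the Kneser graph `KG(n,k)`. -/
def schrijverGraph (n k : ℕ) : SimpleGraph (schrijverVertices n k) :=
  (kneserGraph n k).induce (schrijverVertices n k)

/-- All elements of the `(2k+2)`-cycle that have the same parity as `j`, except `j` itself. -/
def bottomSet (k : ℕ) (j : Fin (2 * k + 2)) : Finset (Fin (2 * k + 2)) :=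
  Finset.univ.filter fun a => a ≠ j ∧ a.val % 2 = j.val % 2

theorem card_bottomSet (k : ℕ) (j : Fin (2 * k + 2)) : (bottomSet k j).card = k := by
  have h : insert j (bottomSet k j) = Finset.univ.image fun i : Fin (k + 1) =>
      (⟨2 * i.val + j.val % 2, by omega⟩ : Fin (2 * k + 2)) := by
    ext a
    simp only [bottomSet, Finset.mem_insert, Finset.mem_filter, Finset.mem_univ, true_and,
      Finset.mem_image, Fin.ext_iff, ne_eq]
    constructor
    · intro ha
      exact ⟨⟨a.val / 2, by omega⟩, by dsimp only; omega⟩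
    · rintro ⟨i, hi⟩
      omega
  have hc := congrArg Finset.card h
  rw [Finset.card_insert_of_notMem (by simp [bottomSet]), Finset.card_image_of_injective _
    (fun a b hab => by simp only [Fin.ext_iff] at hab ⊢; omega), Finset.card_univ,
    Fintype.card_fin] at hc
  omega

theorem isIndepSet_bottomSet (k : ℕ) (j : Fin (2 * k + 2)) :
    (SimpleGraph.cycleGraph (2 * k + 2)).IsIndepSet (bottomSet k j : Set (Fin (2 * k + 2))) := by
  intro a ha b hb _ hab
  simp only [bottomSet, Finset.coe_filter, Finset.mem_univ, true_and, Set.mem_ofPred_eq] at ha hb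
  rw [SimpleGraph.cycleGraph_adj'] at hab
  simp only [Fin.sub_def] at hab
  have h2 : ∀ x : ℕ, x % (2 * k + 2) % 2 = x % 2 := fun x =>
    Nat.mod_mod_of_dvd x ⟨k + 1, by ring⟩
  rcases hab with h | h
  · have := h2 (2 * k + 2 - b.val + a.val)
    omega
  · have := h2 (2 * k + 2 - a.val + b.val)
    omega

/-- The vertex `V_j` of `SG(2k+2,k)`. In the description of `SG(2k+2,k)` as the reduced drum
`D'_{k+1,2k+2}`, the vertices `V_j` form the bottom layer, `V_j` being the vertex `(1,j)`. -/
def bottomVertex (k : ℕ) (j : Fin (2 * k + 2)) : schrijverVertices (2 * k + 2) k :=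
  ⟨⟨bottomSet k j, card_bottomSet k j⟩, isIndepSet_bottomSet k j⟩

/-- The graph `L_k`: the cycle `C_{2k+2}` together with `k+1` extra edges, which are, for even `k`,
the edges connecting opposite vertices (so that `L_k` is a Möbius ladder) and, for odd `k`, the
edges `{i, i+k}` where `i` runs through the first `k+1` vertices. The vertices of the cycle are
numbered `0, …, 2k+1`. -/
def layerGraph (k : ℕ) : SimpleGraph (Fin (2 * k + 2)) :=
  SimpleGraph.cycleGraph (2 * k + 2) ⊔
    SimpleGraph.fromRel fun i j =>
      i.val ≤ k ∧ j.val = i.val + if Even k then k + 1 else k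

/-- The spanning subgraph `Y_k` of `SG(2k+2,k)`: the bottom layer of `SG(2k+2,k)` (a complete
bipartite graph) is replaced by `L_k`, that is, the edges `V_i V_j` with `ij ∉ E(L_k)` are deleted
and all other edges are kept. -/
def kleinGraph (k : ℕ) : SimpleGraph (schrijverVertices (2 * k + 2) k) :=
  (schrijverGraph (2 * k + 2) k).deleteEdges
    {e | ∃ i j, ¬ (layerGraph k).Adj i j ∧ e = s(bottomVertex k i, bottomVertex k j)}

/-- An edge `e` of a graph is (color-)critical if its removal decreases the chromatic number. -/
def IsCriticalEdge {V : Type*} (G : SimpleGraph V) (e : Sym2 V) : Prop :=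
  e ∈ G.edgeSet ∧ (G.deleteEdges {e}).chromaticNumber < G.chromaticNumber

/-- A graph is edge-color-critical if all its edges are critical. -/
def IsEdgeColorCritical {V : Type*} (G : SimpleGraph V) : Prop :=
  ∀ e ∈ G.edgeSet, IsCriticalEdge G e

/-! Call `x` a token of a stable set `A` if neither `x` nor `x + 1` lies in `A`. There is exactly
one token in each parity class, and the two tokens determine `A`. So the vertices are the unordered
pairs of points of opposite parity, and V_{j+1} is the pair {j, j+1}. Along every edge that does not
join two bottom vertices, both tokens move by one step (`bottom_or_tokenMove`). These moves
quadrangulate a Möbius band bounded by the cycle of the V_j. The extra edges of L_k cut a second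
Möbius band with the same boundary into quadrilaterals, so Y_k quadrangulates a Klein bottle.

Why three colours fail: count each step of a walk as +1 or -1 according to the change of colour
modulo 3. The count around a quadrilateral is 0, so the count along the boundary can be computed
inside either band. The first band gives 2 modulo 4 (`sum_colourStep_pairs`), the second gives 0
(`sum_colourStep_moebius` for even k, `sum_colourStep_odd_layer` for odd k).

Why edges are critical: it suffices to 3-colour Y_k minus the edge. The ends of a token move AB miss
exactly two elements u and v, and the colour classes are essentially the star of v, the star of u
and the rest (`TokenMove.exists_colouring`). Deleting an extra edge merges two quadrilaterals into a
hexagon, whose count may be ±6, which removes the obstruction modulo 4. Explicit periodic patterns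
then give the colouring (`LayerColours.exists_colouring_delete`).

For k = 3 the bottom cycle has only 8 steps. If the edges {0,3} and {3,6} are both kept, its count
lies between -4 and 4, is divisible by 3 and is 2 modulo 4, which is impossible. So neither {1,4}
nor {2,5} is critical. -/

/-! ### Stable sets as pairs of tokens -/

theorem fin_val_succ {k : ℕ} (x : Fin (2 * k + 2)) :
    (x + 1).val = x.val + 1 ∧ x.val < 2 * k + 1 ∨ (x + 1).val = 0 ∧ x.val = 2 * k + 1 := by
  have h := Fin.val_add_one (n := 2 * k + 1) x
  have hx := x.isLt
  split_ifs at h with hl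
  · right; exact ⟨h, by rw [hl]; rfl⟩
  · left
    refine ⟨h, ?_⟩
    have : x.val ≠ 2 * k + 1 := fun h' => hl (Fin.ext h')
    omega

/-- Two elements of the cycle are of opposite parity. -/
def OppParity {k : ℕ} (p q : Fin (2 * k + 2)) : Prop := p.val % 2 ≠ q.val % 2

theorem notMem_succ {k : ℕ} (A : schrijverVertices (2 * k + 2) k) {x : Fin (2 * k + 2)}
    (hx : x ∈ A.1.1) : x + 1 ∉ A.1.1 := by
  intro h
  have hA : (SimpleGraph.cycleGraph (2 * k + 2)).IsIndepSet (A.1.1 : Set (Fin (2 * k + 2))) := A.2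
  have hne : x ≠ x + 1 := by
    intro h
    have := fin_val_succ x
    rw [← h] at this
    omega
  refine hA (Finset.mem_coe.2 hx) (Finset.mem_coe.2 h) hne ?_
  rw [SimpleGraph.cycleGraph_adj']
  right
  rw [add_sub_cancel_left]
  rfl

/-- A `k`-set without cyclically consecutive elements, as a vertex of the Schrijver graph. -/
def stableVertex {k : ℕ} (S : Finset (Fin (2 * k + 2))) (hc : S.card = k)
    (hs : ∀ x ∈ S, x + 1 ∉ S) : schrijverVertices (2 * k + 2) k :=
  ⟨⟨S, hc⟩, by
    intro a ha b hb _ hab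
    rw [SimpleGraph.cycleGraph_adj'] at hab
    have h1 : ∀ c : Fin (2 * k + 2), c.val = 1 → c = 1 := fun c hc => Fin.ext hc
    rcases hab with h | h
    · have h := h1 _ h
      rw [sub_eq_iff_eq_add, add_comm 1 b] at h
      exact hs b hb (h ▸ ha)
    · have h := h1 _ h
      rw [sub_eq_iff_eq_add, add_comm 1 a] at h
      exact hs a ha (h ▸ hb)⟩

/-- `x` is a token of `A` if neither `x` nor its successor on the cycle belongs to `A`. -/
def IsToken {k : ℕ} (A : schrijverVertices (2 * k + 2) k) (x : Fin (2 * k + 2)) : Prop :=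
  x ∉ A.1.1 ∧ x + 1 ∉ A.1.1

/-- `A` has exactly the tokens `p` and `q`, which are of opposite parity. -/
def HasTokens {k : ℕ} (A : schrijverVertices (2 * k + 2) k) (p q : Fin (2 * k + 2)) : Prop :=
  OppParity p q ∧ ∀ x, IsToken A x ↔ x = p ∨ x = q

theorem HasTokens.symm {k : ℕ} {A : schrijverVertices (2 * k + 2) k} {p q : Fin (2 * k + 2)}
    (h : HasTokens A p q) : HasTokens A q p :=
  ⟨Ne.symm h.1, fun x => (h.2 x).trans or_comm⟩

theorem HasTokens.left {k : ℕ} {A : schrijverVertices (2 * k + 2) k} {p q : Fin (2 * k + 2)}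
    (h : HasTokens A p q) : IsToken A p := (h.2 p).2 (Or.inl rfl)

theorem HasTokens.right {k : ℕ} {A : schrijverVertices (2 * k + 2) k} {p q : Fin (2 * k + 2)}
    (h : HasTokens A p q) : IsToken A q := (h.2 q).2 (Or.inr rfl)

/-- Each `a ∈ A` rules out exactly one position of the parity class `C`: `a` itself or `a - 1`. By
stability these `k` positions are distinct, and `C` has `k + 1` elements. -/
theorem exists_unique_token {k : ℕ} (A : schrijverVertices (2 * k + 2) k)
    (j : Fin (2 * k + 2)) : ∃ p, ∀ x, (IsToken A x ∧ x.val % 2 = j.val % 2) ↔ x = p := by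
  classical
  set C : Finset (Fin (2 * k + 2)) := Finset.univ.filter fun a => a.val % 2 = j.val % 2 with hC
  have hCc : C.card = k + 1 := by
    have : C = insert j (bottomSet k j) := by
      ext a
      simp only [hC, bottomSet, Finset.mem_filter, Finset.mem_univ, true_and, Finset.mem_insert]
      by_cases h : a = j <;> simp [h]
    rw [this, Finset.card_insert_of_notMem (by simp [bottomSet]), card_bottomSet]
  set U := (A.1.1.filter (· ∈ C)) ∪ (A.1.1.filter (· ∉ C)).image (· - 1) with hU
  have hpar : ∀ x : Fin (2 * k + 2), (x + 1 ∈ C ↔ x ∉ C) := by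
    intro x
    have := fin_val_succ x
    simp only [hC, Finset.mem_filter, Finset.mem_univ, true_and]
    omega
  have hUc : U.card = k := by
    rw [hU, Finset.card_union_of_disjoint, Finset.card_image_of_injective,
      Finset.card_filter_add_card_filter_not, A.1.2]
    · intro a b h
      exact sub_left_injective h
    · rw [Finset.disjoint_left]
      intro a ha hb
      obtain ⟨b, hb', rfl⟩ := Finset.mem_image.1 hb
      have h1 := (Finset.mem_filter.1 ha).1
      have h2 := (Finset.mem_filter.1 hb').1
      have := notMem_succ A h1
      rw [sub_add_cancel] at this
      exact this h2
  have hsub : U ⊆ C := by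
    intro x hx
    rcases Finset.mem_union.1 hx with h | h
    · exact (Finset.mem_filter.1 h).2
    · obtain ⟨b, hb', rfl⟩ := Finset.mem_image.1 h
      have h2 := (Finset.mem_filter.1 hb').2
      by_contra h3
      rw [← hpar, sub_add_cancel] at h3
      exact h2 h3
  have hone : (C \ U).card = 1 := by
    rw [Finset.card_sdiff_of_subset hsub]; omega
  obtain ⟨p, hp⟩ := Finset.card_eq_one.1 hone
  refine ⟨p, fun x => ?_⟩
  rw [← Finset.mem_singleton (a := p) (b := x), ← hp, Finset.mem_sdiff]
  have hxC : x ∈ C ↔ x.val % 2 = j.val % 2 := by simp [hC]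
  rw [← hxC, and_comm]
  refine and_congr_right fun hx => ?_
  have h2 : x ∈ U ↔ x ∈ A.1.1 ∨ x + 1 ∈ A.1.1 := by
    rw [hU, Finset.mem_union, Finset.mem_filter, Finset.mem_image]
    constructor
    · rintro (h | ⟨b, hb, rfl⟩)
      · exact Or.inl h.1
      · right; rw [sub_add_cancel]; exact (Finset.mem_filter.1 hb).1
    · rintro (h | h)
      · exact Or.inl ⟨h, hx⟩
      · refine Or.inr ⟨x + 1, Finset.mem_filter.2 ⟨h, ?_⟩, by rw [add_sub_cancel_right]⟩
        rw [hpar]; simpa using hx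
  rw [h2, IsToken, not_or]

theorem exists_hasTokens {k : ℕ} (A : schrijverVertices (2 * k + 2) k) :
    ∃ p q, HasTokens A p q := by
  obtain ⟨p, hp⟩ := exists_unique_token A 0
  obtain ⟨q, hq⟩ := exists_unique_token A 1
  have hp' := (hp p).2 rfl
  have hq' := (hq q).2 rfl
  have h0 : (0 : Fin (2 * k + 2)).val = 0 := rfl
  have h1 : (1 : Fin (2 * k + 2)).val = 1 := rfl
  refine ⟨p, q, by unfold OppParity; omega, fun x => ⟨fun h => ?_, ?_⟩⟩
  · rcases Nat.mod_two_eq_zero_or_one x.val with h2 | h2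
    · exact Or.inl ((hp x).1 ⟨h, by omega⟩)
    · exact Or.inr ((hq x).1 ⟨h, by omega⟩)
  · rintro (rfl | rfl)
    · exact hp'.1
    · exact hq'.1

theorem hasTokens_of_isToken {k : ℕ} {A : schrijverVertices (2 * k + 2) k}
    {p q : Fin (2 * k + 2)} (hp : IsToken A p) (hq : IsToken A q) (h : OppParity p q) :
    HasTokens A p q := by
  obtain ⟨a, b, hab⟩ := exists_hasTokens A
  have h1 := (hab.2 p).1 hp
  have h2 := (hab.2 q).1 hq
  have hne : p ≠ q := fun e => h (by rw [e])
  rcases h1 with rfl | rfl <;> rcases h2 with rfl | rfl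
  · exact absurd rfl hne
  · exact hab
  · exact hab.symm
  · exact absurd rfl hne

theorem fin_induction_succ {k : ℕ} {P : Fin (2 * k + 2) → Prop} (a : Fin (2 * k + 2)) (ha : P a)
    (hs : ∀ x, P x → P (x + 1)) (x : Fin (2 * k + 2)) : P x := by
  have h : ∀ n : ℕ, P (a + Fin.ofNat (2 * k + 2) n) := by
    intro n
    induction n with
    | zero => simpa using ha
    | succ n ih =>
      have := hs _ ih
      convert this using 1
      rw [add_assoc]
      congr 1
      apply Fin.ext
      simp [Fin.val_add]
  have := h (x - a).val
  rw [Fin.ofNat_val_eq_self] at this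
  simpa using this

/-- Away from the tokens exactly one of `x`, `x + 1` is in the set, so membership propagates around
the cycle from `p`. -/
theorem HasTokens.eq {k : ℕ} {A B : schrijverVertices (2 * k + 2) k} {p q : Fin (2 * k + 2)}
    (hA : HasTokens A p q) (hB : HasTokens B p q) : A = B := by
  apply Subtype.ext
  apply Subtype.ext
  ext x
  refine fin_induction_succ (P := fun x => x ∈ A.1.1 ↔ x ∈ B.1.1) p ?_ ?_ x
  · exact iff_of_false hA.left.1 hB.left.1
  · intro x hx
    by_cases h : x = p ∨ x = q
    · exact iff_of_false ((hA.2 x).2 h).2 ((hB.2 x).2 h).2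
    · have h1 := mt (hA.2 x).1 h
      have h2 := mt (hB.2 x).1 h
      have h3 := notMem_succ A (x := x)
      have h4 := notMem_succ B (x := x)
      unfold IsToken at h1 h2
      tauto

/-! ### Edges as token moves -/

theorem schrijverGraph_adj {k : ℕ} {A B : schrijverVertices (2 * k + 2) k} :
    (schrijverGraph (2 * k + 2) k).Adj A B ↔ A ≠ B ∧ Disjoint A.1.1 B.1.1 := by
  constructor
  · rintro ⟨h1, h2⟩
    exact ⟨fun h => h1 (by rw [h]), h2⟩
  · rintro ⟨h1, h2⟩
    exact ⟨fun h => h1 (Subtype.ext h), h2⟩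

/-- Tokens at `p` and `p'` are cyclically adjacent. -/
def TokenStep {k : ℕ} (p p' : Fin (2 * k + 2)) : Prop := p' = p + 1 ∨ p = p' + 1

theorem TokenStep.symm {k : ℕ} {p p' : Fin (2 * k + 2)} (h : TokenStep p p') : TokenStep p' p :=
  Or.symm h

theorem OppParity.step {k : ℕ} {p q p' q' : Fin (2 * k + 2)} (h : OppParity p q)
    (hp : TokenStep p p') (hq : TokenStep q q') : OppParity p' q' := by
  have h1 := fin_val_succ p
  have h2 := fin_val_succ p'
  have h3 := fin_val_succ q
  have h4 := fin_val_succ q'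
  simp only [TokenStep, Fin.ext_iff, OppParity] at *
  omega

/-- `A` and `B` have tokens `p, q` and `p', q'`, and both tokens move by one step. -/
def TokenMove {k : ℕ} (A B : schrijverVertices (2 * k + 2) k) (p q p' q' : Fin (2 * k + 2)) :
    Prop :=
  HasTokens A p q ∧ HasTokens B p' q' ∧ TokenStep p p' ∧ TokenStep q q'

theorem TokenMove.symm {k : ℕ} {A B : schrijverVertices (2 * k + 2) k}
    {p q p' q' : Fin (2 * k + 2)} (h : TokenMove A B p q p' q') : TokenMove B A p' q' p q :=
  ⟨h.2.1, h.1, h.2.2.1.symm, h.2.2.2.symm⟩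

theorem TokenMove.swap {k : ℕ} {A B : schrijverVertices (2 * k + 2) k}
    {p q p' q' : Fin (2 * k + 2)} (h : TokenMove A B p q p' q') : TokenMove A B q p q' p' :=
  ⟨h.1.symm, h.2.1.symm, h.2.2.2, h.2.2.1⟩

/-- `u` is the later one of the cyclically adjacent elements `p` and `p'`. -/
def StepMax {k : ℕ} (p p' u : Fin (2 * k + 2)) : Prop :=
  (p + 1 = u ∧ p' = u) ∨ (p = u ∧ p' + 1 = u)

theorem TokenStep.exists_max {k : ℕ} {p p' : Fin (2 * k + 2)} (h : TokenStep p p') :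
    ∃ u, StepMax p p' u := by
  rcases h with h | h
  · exact ⟨p', Or.inl ⟨h.symm, rfl⟩⟩
  · exact ⟨p, Or.inr ⟨rfl, h.symm⟩⟩

/-- Two tokens of opposite parity can cross the same element only by exchanging places. -/
theorem TokenStep.max_ne {k : ℕ} {p q p' q' u v : Fin (2 * k + 2)} (hpq : OppParity p q)
    (hu : StepMax p p' u)
    (hv : StepMax q q' v) (hne : ¬ (p' = q ∧ q' = p)) : u ≠ v := by
  rintro rfl
  rcases hu with ⟨h1, h2⟩ | ⟨h1, h2⟩ <;> rcases hv with ⟨h3, h4⟩ | ⟨h3, h4⟩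
  · exact hpq (by rw [add_right_cancel (h1.trans h3.symm)])
  · exact hne ⟨h2.trans h3.symm, add_right_cancel (h4.trans h1.symm)⟩
  · exact hne ⟨add_right_cancel (h2.trans h3.symm), h4.trans h1.symm⟩
  · exact hpq (by rw [h1, h3])

theorem isToken_of_compl {k : ℕ} {A B : schrijverVertices (2 * k + 2) k}
    {p q p' q' u v : Fin (2 * k + 2)} (hA : HasTokens A p q) (huv : u ≠ v)
    (hu : StepMax p p' u)
    (hv : StepMax q q' v)
    (hB : ∀ x, x ∈ B.1.1 ↔ x ≠ u ∧ x ≠ v ∧ x ∉ A.1.1) : IsToken B p' := by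
  unfold IsToken
  rw [hB, hB]
  rcases hu with ⟨h1, h2⟩ | ⟨h1, h2⟩
  · subst h1 h2
    refine ⟨fun h => h.1 rfl, fun h => ?_⟩
    rcases (hA.2 (p + 1)).1 ⟨hA.left.2, h.2.2⟩ with h3 | h3
    · have := fin_val_succ p
      rw [h3] at this; omega
    · rcases hv with ⟨h4, _⟩ | ⟨h4, _⟩
      · exact h.2.1 (by rw [← h4, h3])
      · exact huv (by rw [← h4, h3])
  · subst h1
    subst h2
    refine ⟨fun h => ?_, fun h => h.1 rfl⟩
    rcases (hA.2 p').1 ⟨h.2.2, hA.left.1⟩ with h3 | h3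
    · have := fin_val_succ p'
      rw [← h3] at this; omega
    · rcases hv with ⟨h4, _⟩ | ⟨h4, _⟩
      · exact huv (by rw [← h4, h3])
      · exact h.2.1 (by rw [← h4, h3])

/-- Removing from the complement of `A` one element next to each token gives a vertex whose tokens
are obtained by moving the two tokens of `A` across these elements. -/
theorem exists_tokenMove {k : ℕ} {A : schrijverVertices (2 * k + 2) k}
    {p q p' q' : Fin (2 * k + 2)} (hA : HasTokens A p q) (hp : TokenStep p p')
    (hq : TokenStep q q') (hne : ¬ (p' = q ∧ q' = p)) :
    ∃ B, HasTokens B p' q' ∧ Disjoint A.1.1 B.1.1 := by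
  classical
  obtain ⟨u, hu⟩ := hp.exists_max
  obtain ⟨v, hv⟩ := hq.exists_max
  have huv := TokenStep.max_ne hA.1 hu hv hne
  have hopp := hA.1.step hp hq
  have huA : u ∉ A.1.1 := by
    rcases hu with ⟨h, _⟩ | ⟨h, _⟩
    · exact h ▸ hA.left.2
    · exact h ▸ hA.left.1
  have hvA : v ∉ A.1.1 := by
    rcases hv with ⟨h, _⟩ | ⟨h, _⟩
    · exact h ▸ hA.right.2
    · exact h ▸ hA.right.1
  have hcard : ((insert u (insert v A.1.1))ᶜ).card = k := by
    rw [Finset.card_compl, Finset.card_insert_of_notMem (by simp [huv, huA]),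
      Finset.card_insert_of_notMem hvA, A.1.2, Fintype.card_fin]
    omega
  have hmem : ∀ x, x ∈ (insert u (insert v A.1.1))ᶜ ↔ x ≠ u ∧ x ≠ v ∧ x ∉ A.1.1 := by
    intro x
    simp only [Finset.mem_compl, Finset.mem_insert, not_or, ne_eq]
  let B := stableVertex (insert u (insert v A.1.1))ᶜ hcard (by
    intro x hx hx1
    rw [hmem] at hx hx1
    rcases (hA.2 x).1 ⟨hx.2.2, hx1.2.2⟩ with rfl | rfl
    · rcases hu with ⟨h, _⟩ | ⟨h, _⟩
      · exact hx1.1 h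
      · exact hx.1 h
    · rcases hv with ⟨h, _⟩ | ⟨h, _⟩
      · exact hx1.2.1 h
      · exact hx.2.1 h)
  have hB : ∀ x, x ∈ B.1.1 ↔ x ≠ u ∧ x ≠ v ∧ x ∉ A.1.1 := hmem
  refine ⟨B, hasTokens_of_isToken (isToken_of_compl hA huv hu hv hB)
    (isToken_of_compl hA.symm huv.symm hv hu fun x => by rw [hB]; tauto) hopp, ?_⟩
  rw [Finset.disjoint_left]
  intro x hx hx'
  exact ((hB x).1 hx').2.2 hx

theorem TokenMove.adj {k : ℕ} {A B : schrijverVertices (2 * k + 2) k}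
    {p q p' q' : Fin (2 * k + 2)} (h : TokenMove A B p q p' q') (hne : A ≠ B) :
    (schrijverGraph (2 * k + 2) k).Adj A B := by
  obtain ⟨B', hB', hd⟩ := exists_tokenMove h.1 h.2.2.1 h.2.2.2 (by
    rintro ⟨rfl, rfl⟩
    exact hne (h.1.eq h.2.1.symm))
  rw [h.2.1.eq hB'] at hne ⊢
  exact schrijverGraph_adj.2 ⟨hne, hd⟩

theorem hasTokens_bottomVertex (k : ℕ) (j : Fin (2 * k + 2)) :
    HasTokens (bottomVertex k (j + 1)) j (j + 1) := by
  have h1 := fin_val_succ j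
  have h2 := fin_val_succ (j + 1)
  have hmem : ∀ x, x ∈ (bottomVertex k (j + 1)).1.1 ↔
      x ≠ j + 1 ∧ x.val % 2 = (j + 1).val % 2 := by
    intro x
    simp [bottomVertex, bottomSet]
  apply hasTokens_of_isToken
  · unfold IsToken
    rw [hmem, hmem]
    exact ⟨fun h => by omega, fun h => h.1 rfl⟩
  · unfold IsToken
    rw [hmem, hmem]
    exact ⟨fun h => h.1 rfl, fun h => by omega⟩
  · unfold OppParity; omega

theorem hasTokens_bottomVertex' (k : ℕ) {i j : Fin (2 * k + 2)} (h : j = i + 1) :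
    HasTokens (bottomVertex k j) i j := h ▸ hasTokens_bottomVertex k i

theorem mem_bottomVertex {k : ℕ} {j x : Fin (2 * k + 2)} :
    x ∈ (bottomVertex k j).1.1 ↔ x ≠ j ∧ x.val % 2 = j.val % 2 := by
  simp [bottomVertex, bottomSet]

/-- `A` is one of the vertices `V_j`. -/
def IsBottom {k : ℕ} (A : schrijverVertices (2 * k + 2) k) : Prop := ∃ j, A = bottomVertex k j

theorem HasTokens.isBottom {k : ℕ} {A : schrijverVertices (2 * k + 2) k}
    {p q : Fin (2 * k + 2)} (h : HasTokens A p q) (hpq : TokenStep p q) : IsBottom A := by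
  rcases hpq with rfl | rfl
  · exact ⟨_, h.eq (hasTokens_bottomVertex k p)⟩
  · exact ⟨_, h.symm.eq (hasTokens_bottomVertex k q)⟩

/-- The tokens of `B` are not adjacent, so `p - 1` and `p + 2` lie in `B` and hence not in `A`. If
`p + 1 ∉ A`, then `p + 1` is a token of `A`; otherwise `p ∉ A` and `p - 1` is one. -/
theorem isToken_near {k : ℕ} {A B : schrijverVertices (2 * k + 2) k}
    (hd : Disjoint A.1.1 B.1.1) {p q : Fin (2 * k + 2)} (hB : HasTokens B p q)
    (hn : ¬ IsBottom B) : ∃ p', TokenStep p p' ∧ IsToken A p' := by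
  have hs : ¬ TokenStep p q := fun h => hn (hB.isBottom h)
  obtain ⟨r, hr⟩ : ∃ r, p = r + 1 := ⟨p - 1, by rw [sub_add_cancel]⟩
  have hr' := fin_val_succ r
  have hp' := fin_val_succ p
  have hp'' := fin_val_succ (p + 1)
  rw [← hr] at hr'
  have hrB : r ∈ B.1.1 := by
    by_contra h
    rcases (hB.2 r).1 ⟨h, hr ▸ hB.left.1⟩ with h1 | h1
    · rw [h1] at hr'; omega
    · exact hs (Or.inr (by rw [hr, h1]))
  have hpB : p + 1 + 1 ∈ B.1.1 := by
    by_contra h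
    rcases (hB.2 (p + 1)).1 ⟨hB.left.2, h⟩ with h1 | h1
    · rw [h1] at hp'; omega
    · exact hs (Or.inl h1.symm)
  have hrA := Finset.disjoint_right.1 hd hrB
  have hpA := Finset.disjoint_right.1 hd hpB
  by_cases h1 : p + 1 ∈ A.1.1
  · have h2 : p ∉ A.1.1 := fun h => notMem_succ A h h1
    exact ⟨r, Or.inr hr, hrA, hr ▸ h2⟩
  · exact ⟨p + 1, Or.inl rfl, h1, hpA⟩

theorem exists_tokenMove_of_disjoint {k : ℕ} {A B : schrijverVertices (2 * k + 2) k}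
    (hd : Disjoint A.1.1 B.1.1) (hn : ¬ IsBottom B) : ∃ p q p' q', TokenMove A B p q p' q' := by
  obtain ⟨p, q, hB⟩ := exists_hasTokens B
  obtain ⟨p', hp, hp'⟩ := isToken_near hd hB hn
  obtain ⟨q', hq, hq'⟩ := isToken_near hd hB.symm hn
  exact ⟨p', q', p, q, hasTokens_of_isToken hp' hq' (hB.1.step hp hq), hB, hp.symm, hq.symm⟩

theorem bottom_or_tokenMove {k : ℕ} {A B : schrijverVertices (2 * k + 2) k}
    (h : (schrijverGraph (2 * k + 2) k).Adj A B) :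
    (∃ i j, A = bottomVertex k i ∧ B = bottomVertex k j) ∨
      ∃ p q p' q', TokenMove A B p q p' q' := by
  have hd := (schrijverGraph_adj.1 h).2
  by_cases hB : IsBottom B
  · by_cases hA : IsBottom A
    · obtain ⟨i, hi⟩ := hA
      obtain ⟨j, hj⟩ := hB
      exact Or.inl ⟨i, j, hi, hj⟩
    · obtain ⟨p, q, p', q', h⟩ := exists_tokenMove_of_disjoint hd.symm hA
      exact Or.inr ⟨_, _, _, _, h.symm⟩
  · exact Or.inr (exists_tokenMove_of_disjoint hd hB)

theorem HasTokens.unique {k : ℕ} {A : schrijverVertices (2 * k + 2) k}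
    {p q x y : Fin (2 * k + 2)} (h : HasTokens A p q) (h' : HasTokens A x y) :
    (x = p ∧ y = q) ∨ (x = q ∧ y = p) := by
  have hne : x ≠ y := fun e => h'.1 (by rw [e])
  rcases (h.2 x).1 h'.left with rfl | rfl <;> rcases (h.2 y).1 h'.right with rfl | rfl
  · exact absurd rfl hne
  · exact Or.inl ⟨rfl, rfl⟩
  · exact Or.inr ⟨rfl, rfl⟩
  · exact absurd rfl hne

theorem exists_eq_succ {k : ℕ} (x : Fin (2 * k + 2)) : ∃ r, x = r + 1 :=
  ⟨x - 1, by rw [sub_add_cancel]⟩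

theorem oppParity_succ {k : ℕ} (r : Fin (2 * k + 2)) : OppParity r (r + 1) := by
  have := fin_val_succ r
  unfold OppParity
  omega

theorem OppParity.symm {k : ℕ} {p q : Fin (2 * k + 2)} (h : OppParity p q) : OppParity q p :=
  Ne.symm h

theorem not_oppParity {k : ℕ} {p q r : Fin (2 * k + 2)} (h : OppParity p q)
    (h' : OppParity q r) : ¬ OppParity p r := by
  unfold OppParity at *
  omega

/-! ### The bottom layer and the edges of Y_k -/

theorem bottomVertex_injective {k : ℕ} (hk : 1 ≤ k) : Function.Injective (bottomVertex k) := by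
  intro i j hij
  obtain ⟨r, rfl⟩ := exists_eq_succ i
  obtain ⟨t, rfl⟩ := exists_eq_succ j
  have h1 := hasTokens_bottomVertex k r
  rw [hij] at h1
  rcases h1.unique (hasTokens_bottomVertex k t) with ⟨h, _⟩ | ⟨h, h'⟩
  · rw [h]
  · have h2 := fin_val_succ r
    have h3 := fin_val_succ t
    simp only [Fin.ext_iff] at h h'
    omega

theorem layerGraph_adj_of_step {k : ℕ} {i j : Fin (2 * k + 2)} (h : TokenStep i j) :
    (layerGraph k).Adj i j := by
  unfold layerGraph
  rw [SimpleGraph.sup_adj, SimpleGraph.cycleGraph_adj']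
  left
  rcases h with rfl | rfl
  · right
    rw [add_sub_cancel_left]
    rfl
  · left
    rw [add_sub_cancel_left]
    rfl

theorem layerGraph_adj {k : ℕ} {i j : Fin (2 * k + 2)} :
    (layerGraph k).Adj i j ↔ TokenStep i j ∨
      (i ≠ j ∧ ((i.val ≤ k ∧ j.val = i.val + if Even k then k + 1 else k) ∨
        (j.val ≤ k ∧ i.val = j.val + if Even k then k + 1 else k))) := by
  refine ⟨fun h => ?_, fun h => ?_⟩
  · unfold layerGraph at h
    rw [SimpleGraph.sup_adj, SimpleGraph.cycleGraph_adj', SimpleGraph.fromRel_adj] at h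
    have h1 : ∀ c : Fin (2 * k + 2), c.val = 1 → c = 1 := fun c hc => Fin.ext hc
    rcases h with (h | h) | h
    · have h := h1 _ h
      rw [sub_eq_iff_eq_add, add_comm 1 j] at h
      exact Or.inl (Or.inr h)
    · have h := h1 _ h
      rw [sub_eq_iff_eq_add, add_comm 1 i] at h
      exact Or.inl (Or.inl h)
    · exact Or.inr h
  · rcases h with h | h
    · exact layerGraph_adj_of_step h
    · unfold layerGraph
      rw [SimpleGraph.sup_adj, SimpleGraph.fromRel_adj]
      exact Or.inr h

theorem layerGraph_adj_oppParity {k : ℕ} {i j : Fin (2 * k + 2)} (h : (layerGraph k).Adj i j) :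
    OppParity i j := by
  rcases layerGraph_adj.1 h with (rfl | rfl) | ⟨_, h⟩
  · exact oppParity_succ i
  · exact (oppParity_succ j).symm
  · unfold OppParity
    rcases Nat.even_or_odd k with hk | hk
    · rw [if_pos hk] at h
      obtain ⟨m, rfl⟩ := hk
      omega
    · rw [if_neg (Nat.not_even_iff_odd.2 hk)] at h
      obtain ⟨m, rfl⟩ := hk
      omega

theorem kleinGraph_adj {k : ℕ} {A B : schrijverVertices (2 * k + 2) k} :
    (kleinGraph k).Adj A B ↔ (schrijverGraph (2 * k + 2) k).Adj A B ∧
      ∀ i j, s(A, B) = s(bottomVertex k i, bottomVertex k j) → (layerGraph k).Adj i j := by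
  unfold kleinGraph
  rw [SimpleGraph.deleteEdges_adj, Set.mem_ofPred_eq]
  refine and_congr_right fun _ => ?_
  push Not
  exact ⟨fun h i j e => by_contra fun hn => h i j hn e, fun h i j hn e => hn (h i j e)⟩

theorem disjoint_bottomVertex {k : ℕ} {i j : Fin (2 * k + 2)} (h : OppParity i j) :
    Disjoint (bottomVertex k i).1.1 (bottomVertex k j).1.1 := by
  rw [Finset.disjoint_left]
  intro x hx hx'
  exact h ((mem_bottomVertex.1 hx).2.symm.trans (mem_bottomVertex.1 hx').2)

theorem kleinGraph_adj_bottomVertex {k : ℕ} (hk : 1 ≤ k) {i j : Fin (2 * k + 2)} :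
    (kleinGraph k).Adj (bottomVertex k i) (bottomVertex k j) ↔ (layerGraph k).Adj i j := by
  rw [kleinGraph_adj]
  constructor
  · exact fun h => h.2 i j rfl
  · intro h
    refine ⟨schrijverGraph_adj.2 ⟨fun e => h.ne (bottomVertex_injective hk e),
      disjoint_bottomVertex (layerGraph_adj_oppParity h)⟩, fun a b e => ?_⟩
    rw [Sym2.eq_iff] at e
    rcases e with ⟨h1, h2⟩ | ⟨h1, h2⟩
    · rwa [← bottomVertex_injective hk h1, ← bottomVertex_injective hk h2]
    · rw [← bottomVertex_injective hk h1, ← bottomVertex_injective hk h2]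
      exact h.symm

/-- Hence no token move is deleted in passing from the Schrijver graph to Y_k, and no extra edge
that is not a rim edge is a token move. -/
theorem tokenStep_of_tokenMove_bottom {k : ℕ} (hk : 2 ≤ k) {i j p q p' q' : Fin (2 * k + 2)}
    (h : TokenMove (bottomVertex k i) (bottomVertex k j) p q p' q') (hij : i ≠ j) :
    TokenStep i j := by
  obtain ⟨r, rfl⟩ := exists_eq_succ i
  obtain ⟨t, rfl⟩ := exists_eq_succ j
  have hrt : r ≠ t := fun e => hij (by rw [e])
  have aux : ∀ {a b : Fin (2 * k + 2)}, TokenStep a b → TokenStep (a + 1) (b + 1) := by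
    intro a b hab
    rcases hab with rfl | rfl
    · exact Or.inl rfl
    · exact Or.inr rfl
  have cross : TokenStep r (t + 1) → TokenStep (r + 1) t → False := by
    intro h1 h2
    have a1 := fin_val_succ r
    have a2 := fin_val_succ t
    have a3 := fin_val_succ (r + 1)
    have a4 := fin_val_succ (t + 1)
    simp only [TokenStep, Fin.ext_iff, ne_eq] at h1 h2 hrt
    omega
  obtain ⟨h1, h2, h3, h4⟩ := h
  rcases (hasTokens_bottomVertex k r).unique h1 with ⟨rfl, rfl⟩ | ⟨rfl, rfl⟩ <;>
    rcases (hasTokens_bottomVertex k t).unique h2 with ⟨rfl, rfl⟩ | ⟨rfl, rfl⟩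
  · exact h4
  · exact (cross h3 h4).elim
  · exact (cross h4 h3).elim
  · exact h3

theorem TokenMove.adj_klein {k : ℕ} (hk : 2 ≤ k) {A B : schrijverVertices (2 * k + 2) k}
    {p q p' q' : Fin (2 * k + 2)} (h : TokenMove A B p q p' q') (hne : A ≠ B) :
    (kleinGraph k).Adj A B := by
  rw [kleinGraph_adj]
  refine ⟨h.adj hne, fun i j e => ?_⟩
  rw [Sym2.eq_iff] at e
  rcases e with ⟨rfl, rfl⟩ | ⟨rfl, rfl⟩
  · exact layerGraph_adj_of_step (tokenStep_of_tokenMove_bottom hk h fun e => hne (by rw [e]))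
  · exact (layerGraph_adj_of_step
      (tokenStep_of_tokenMove_bottom hk h fun e => hne (by rw [e]))).symm

theorem TokenStep.tokenMove_bottom {k : ℕ} {i j : Fin (2 * k + 2)} (h : TokenStep i j) :
    ∃ p p', TokenMove (bottomVertex k i) (bottomVertex k j) p i p' j := by
  obtain ⟨r, rfl⟩ := exists_eq_succ i
  obtain ⟨t, rfl⟩ := exists_eq_succ j
  refine ⟨r, t, hasTokens_bottomVertex k r, hasTokens_bottomVertex k t, ?_, h⟩
  rcases h with h | h
  · exact Or.inl (add_right_cancel h)
  · exact Or.inr (add_right_cancel h)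

theorem kleinGraph_cases {k : ℕ} {A B : schrijverVertices (2 * k + 2) k}
    (h : (kleinGraph k).Adj A B) :
    (∃ i j, A = bottomVertex k i ∧ B = bottomVertex k j ∧ (layerGraph k).Adj i j ∧
        ¬ TokenStep i j) ∨ ∃ p q p' q', TokenMove A B p q p' q' := by
  rw [kleinGraph_adj] at h
  rcases bottom_or_tokenMove h.1 with ⟨i, j, rfl, rfl⟩ | h'
  · by_cases hs : TokenStep i j
    · obtain ⟨p, p', hm⟩ := hs.tokenMove_bottom
      exact Or.inr ⟨_, _, _, _, hm⟩
    · exact Or.inl ⟨i, j, rfl, rfl, h.2 i j rfl, hs⟩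
  · exact Or.inr h'

/-! ### Deleting a token move -/

theorem eq_of_notMem_of_disjoint {k : ℕ} {A B : schrijverVertices (2 * k + 2) k}
    (hd : Disjoint A.1.1 B.1.1) {u v w : Fin (2 * k + 2)} (huv : u ≠ v)
    (hu : u ∉ A.1.1 ∧ u ∉ B.1.1) (hv : v ∉ A.1.1 ∧ v ∉ B.1.1) (hw : w ∉ A.1.1 ∧ w ∉ B.1.1) :
    w = u ∨ w = v := by
  classical
  have hc : ((A.1.1 ∪ B.1.1)ᶜ).card = 2 := by
    rw [Finset.card_compl, Finset.card_union_of_disjoint hd, A.1.2, B.1.2, Fintype.card_fin]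
    omega
  have hsub : {u, v} ⊆ (A.1.1 ∪ B.1.1)ᶜ := by
    intro x hx
    rw [Finset.mem_insert, Finset.mem_singleton] at hx
    rw [Finset.mem_compl, Finset.mem_union, not_or]
    rcases hx with rfl | rfl
    · exact hu
    · exact hv
  have heq := Finset.eq_of_subset_of_card_le hsub (by rw [hc, Finset.card_pair huv])
  have : w ∈ ({u, v} : Finset (Fin (2 * k + 2))) := by
    rw [heq, Finset.mem_compl, Finset.mem_union, not_or]
    exact hw
  simpa using this

theorem StepMax.notMem {k : ℕ} {A B : schrijverVertices (2 * k + 2) k}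
    {p p' u : Fin (2 * k + 2)} (h : StepMax p p' u) (hA : IsToken A p) (hB : IsToken B p') :
    u ∉ A.1.1 ∧ u ∉ B.1.1 := by
  rcases h with ⟨rfl, rfl⟩ | ⟨rfl, rfl⟩
  · exact ⟨hA.2, hB.1⟩
  · exact ⟨hA.1, hB.2⟩

theorem TokenMove.max_ne {k : ℕ} {A B : schrijverVertices (2 * k + 2) k}
    {p q p' q' u v : Fin (2 * k + 2)} (h : TokenMove A B p q p' q') (hne : A ≠ B)
    (hu : StepMax p p' u) (hv : StepMax q q' v) : u ≠ v :=
  TokenStep.max_ne h.1.1 hu hv (by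
    rintro ⟨rfl, rfl⟩
    exact hne (h.1.eq h.2.1.symm))

theorem StepMax.left_cases {k : ℕ} {p p' r : Fin (2 * k + 2)} (h : StepMax p p' (r + 1)) :
    (p = r ∧ p' = r + 1) ∨ (p = r + 1 ∧ p' = r) := by
  rcases h with ⟨h1, h2⟩ | ⟨h1, h2⟩
  · exact Or.inl ⟨add_right_cancel h1, h2⟩
  · exact Or.inr ⟨h1, add_right_cancel h2⟩

/-- An edge along which both tokens move is determined by the two elements its ends miss. -/
theorem TokenMove.edge_eq {k : ℕ} {A B C D : schrijverVertices (2 * k + 2) k}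
    {p q p' q' x y x' y' u v : Fin (2 * k + 2)} (h : TokenMove A B p q p' q')
    (hu : StepMax p p' u) (hv : StepMax q q' v) (h' : TokenMove C D x y x' y')
    (hu' : StepMax x x' u) (hv' : StepMax y y' v) : s(C, D) = s(A, B) := by
  obtain ⟨r, rfl⟩ := exists_eq_succ u
  obtain ⟨t, rfl⟩ := exists_eq_succ v
  have hr := oppParity_succ r
  have ht := oppParity_succ t
  rcases hu.left_cases with ⟨rfl, rfl⟩ | ⟨rfl, rfl⟩ <;>
    rcases hv.left_cases with ⟨rfl, rfl⟩ | ⟨rfl, rfl⟩ <;>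
    rcases hu'.left_cases with ⟨rfl, rfl⟩ | ⟨rfl, rfl⟩ <;>
    rcases hv'.left_cases with ⟨rfl, rfl⟩ | ⟨rfl, rfl⟩ <;>
    first
    | exact congrArg₂ (fun a b => s(a, b)) (h'.1.eq h.1) (h'.2.1.eq h.2.1)
    | exact (congrArg₂ (fun a b => s(a, b)) (h'.1.eq h.2.1) (h'.2.1.eq h.1)).trans Sym2.eq_swap
    | exact (not_oppParity h.1.1 ht h'.1.1).elim
    | exact (not_oppParity h.1.1 ht.symm h'.1.1).elim
    | exact (not_oppParity h.2.1.1 ht h'.1.1).elim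
    | exact (not_oppParity h.2.1.1 ht.symm h'.1.1).elim

/-- If `v = u + 1`, opposite parity keeps the tokens from meeting at `u`, so both move in the same
direction, between {u-1, u} and {u, u+1}. The case `u = v + 1` is the mirror image. -/
theorem TokenMove.eq_bottomVertex_of_consecutive {k : ℕ}
    {A B : schrijverVertices (2 * k + 2) k} {p q p' q' u v : Fin (2 * k + 2)}
    (h : TokenMove A B p q p' q') (hu : StepMax p p' u) (hv : StepMax q q' v)
    (huv : TokenStep u v) : A = bottomVertex k u ∨ B = bottomVertex k u := by
  obtain ⟨r, rfl⟩ := exists_eq_succ u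
  obtain ⟨t, rfl⟩ := exists_eq_succ v
  have hb := hasTokens_bottomVertex k r
  have h1 := h.1.1
  have h2 := h.2.1.1
  rcases huv with huv | huv
  · obtain rfl := add_right_cancel huv
    rcases hu.left_cases with ⟨rfl, rfl⟩ | ⟨rfl, rfl⟩ <;>
      rcases hv.left_cases with ⟨rfl, rfl⟩ | ⟨rfl, rfl⟩
    · exact Or.inl (h.1.eq hb)
    · exact absurd rfl h2
    · exact absurd rfl h1
    · exact Or.inr (h.2.1.eq hb)
  · obtain rfl := add_right_cancel huv
    rcases hu.left_cases with ⟨rfl, rfl⟩ | ⟨rfl, rfl⟩ <;>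
      rcases hv.left_cases with ⟨rfl, rfl⟩ | ⟨rfl, rfl⟩
    · exact Or.inr (h.2.1.eq hb.symm)
    · exact absurd rfl h1
    · exact absurd rfl h2
    · exact Or.inl (h.1.eq hb.symm)

theorem TokenMove.eq_bottomVertex_right {k : ℕ} {B : schrijverVertices (2 * k + 2) k}
    {p q p' q' u v : Fin (2 * k + 2)} (h : TokenMove (bottomVertex k u) B p q p' q')
    (hu : StepMax p p' u) (hv : StepMax q q' v) (huv : u ≠ v) : B = bottomVertex k v := by
  obtain ⟨r, rfl⟩ := exists_eq_succ u
  obtain ⟨t, rfl⟩ := exists_eq_succ v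
  have hrr : ∀ x : Fin (2 * k + 2), x ≠ x + 1 := fun x e => oppParity_succ x (by rw [← e])
  rcases (hasTokens_bottomVertex k r).unique h.1 with ⟨rfl, rfl⟩ | ⟨rfl, rfl⟩
  · rcases hu.left_cases with ⟨_, rfl⟩ | ⟨h1, _⟩
    · rcases hv.left_cases with ⟨rfl, rfl⟩ | ⟨h1, _⟩
      · exact h.2.1.eq (hasTokens_bottomVertex k _)
      · exact absurd h1 huv
    · exact absurd h1 (hrr _)
  · rcases hu.left_cases with ⟨h1, _⟩ | ⟨_, rfl⟩
    · exact absurd h1.symm (hrr _)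
    · rcases hv.left_cases with ⟨rfl, rfl⟩ | ⟨rfl, rfl⟩
      · exact absurd rfl huv
      · exact h.2.1.eq (hasTokens_bottomVertex k _).symm

/-- The obstruction to giving V_u the colour of the star of `u`: a neighbour that contains `u` and
avoids `v` forces `u` and `v` to be consecutive. -/
theorem tokenStep_of_adj_bottomVertex {k : ℕ} {D : schrijverVertices (2 * k + 2) k}
    {u v : Fin (2 * k + 2)} (h : (kleinGraph k).Adj (bottomVertex k u) D) (huD : u ∈ D.1.1)
    (hv : v ∉ (bottomVertex k u).1.1) (hvD : v ∉ D.1.1) : TokenStep u v := by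
  have hd := (schrijverGraph_adj.1 (kleinGraph_adj.1 h).1).2
  rcases kleinGraph_cases h with ⟨i, j, hi, rfl, hij, _⟩ | ⟨x, y, x', y', hm⟩
  · have := (kleinGraph_adj.1 h).2 u j rfl
    exact (layerGraph_adj_oppParity this (mem_bottomVertex.1 huD).2).elim
  · obtain ⟨r, rfl⟩ := exists_eq_succ u
    have key : ∀ {x' y'}, TokenMove (bottomVertex k (r + 1)) D r (r + 1) x' y' →
        TokenStep (r + 1) v := by
      rintro x' y' ⟨hA, hB, h1, h2⟩
      rcases h1 with rfl | rfl
      · exact (hB.left.1 huD).elim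
      · rcases h2 with rfl | h2
        · have hne : x' + 1 ≠ x' + 1 + 1 + 1 := by
            intro e
            have e' : x' = x' + 1 + 1 := add_right_cancel e
            rw [← e'] at huD
            exact hB.left.1 huD
          rcases eq_of_notMem_of_disjoint hd hne ⟨hA.left.1, hB.left.2⟩
            ⟨hA.right.2, hB.right.1⟩ ⟨hv, hvD⟩ with rfl | rfl
          · exact Or.inr rfl
          · exact Or.inl rfl
        · exact (hB.right.2 (h2 ▸ huD)).elim
    rcases (hasTokens_bottomVertex k r).unique hm.1 with ⟨rfl, rfl⟩ | ⟨rfl, rfl⟩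
    · exact key hm
    · exact key hm.swap

/-- Deleting an edge along which both tokens move makes `Y_k` three-colourable: the colours are
two stars and the rest, except that one vertex `V_u` may have to join a star. -/
theorem TokenMove.exists_colouring {k : ℕ} {A B : schrijverVertices (2 * k + 2) k}
    {p q p' q' : Fin (2 * k + 2)} (h : TokenMove A B p q p' q') (hne : A ≠ B) :
    ∃ c : schrijverVertices (2 * k + 2) k → Fin 3,
      ∀ C D, (kleinGraph k).Adj C D → c C = c D → s(C, D) = s(A, B) := by
  classical
  obtain ⟨u, hu⟩ := h.2.2.1.exists_max
  obtain ⟨v, hv⟩ := h.2.2.2.exists_max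
  have huv := h.max_ne hne hu hv
  -- Besides AB, the pair V_u V_v also misses `u` and `v` and might be an edge. Unless V_u is itself
  -- an end of AB, it is moved to the star of `u`.
  set m : Prop := ¬ (A = bottomVertex k u ∨ B = bottomVertex k u) with hm
  refine ⟨fun C => if v ∈ C.1.1 then 2 else if u ∈ C.1.1 ∨ (m ∧ C = bottomVertex k u) then 1
    else 0, fun C D hCD hc => ?_⟩
  have hsg := (kleinGraph_adj.1 hCD).1
  obtain ⟨hCDne, hd⟩ := schrijverGraph_adj.1 hsg
  have hd' := Finset.disjoint_left.1 hd
  by_cases hvC : v ∈ C.1.1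
  · have hvD := hd' hvC
    simp only [hvC, hvD, if_true, if_false] at hc
    split_ifs at hc
    · exact absurd hc (by decide)
    · exact absurd hc (by decide)
  by_cases hvD : v ∈ D.1.1
  · simp only [hvC, hvD, if_true, if_false] at hc
    split_ifs at hc
    · exact absurd hc (by decide)
    · exact absurd hc (by decide)
  simp only [hvC, hvD, if_false] at hc
  by_cases hC1 : u ∈ C.1.1 ∨ (m ∧ C = bottomVertex k u)
  · by_cases hD1 : u ∈ D.1.1 ∨ (m ∧ D = bottomVertex k u)
    · exfalso
      rcases hC1 with h1 | ⟨h1, rfl⟩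
      · rcases hD1 with h2 | ⟨h2, rfl⟩
        · exact hd' h1 h2
        · exact h2 (h.eq_bottomVertex_of_consecutive hu hv
            (tokenStep_of_adj_bottomVertex hCD.symm h1 hvD hvC))
      · rcases hD1 with h2 | ⟨h2, rfl⟩
        · exact h1 (h.eq_bottomVertex_of_consecutive hu hv
            (tokenStep_of_adj_bottomVertex hCD h2 hvC hvD))
        · exact hCDne rfl
    · rw [if_pos hC1, if_neg hD1] at hc
      exact absurd hc (by decide)
  by_cases hD1 : u ∈ D.1.1 ∨ (m ∧ D = bottomVertex k u)
  · rw [if_neg hC1, if_pos hD1] at hc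
    exact absurd hc (by decide)
  push Not at hC1 hD1
  -- If V_u has the third colour then `m` fails, so V_u is an end of AB, and the other end must be
  -- V_v.
  have key : ∀ C D : schrijverVertices (2 * k + 2) k, (kleinGraph k).Adj C D →
      (m → C ≠ bottomVertex k u) → C = bottomVertex k u → D = bottomVertex k v →
      s(C, D) = s(A, B) := by
    intro C D _ h1 h2 h3
    subst h2 h3
    have hm' : ¬ m := fun hm' => h1 hm' rfl
    rw [hm, not_not] at hm'
    rcases hm' with rfl | rfl
    · rw [h.eq_bottomVertex_right hu hv huv]
    · rw [h.symm.eq_bottomVertex_right (Or.symm (by simpa [StepMax, and_comm] using hu))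
        (Or.symm (by simpa [StepMax, and_comm] using hv)) huv]
      exact Sym2.eq_swap
  rcases kleinGraph_cases hCD with ⟨i, j, rfl, rfl, hij, _⟩ | ⟨x, y, x', y', hxy⟩
  · have hpar := layerGraph_adj_oppParity hij
    have hi : i ∉ (bottomVertex k i).1.1 ∧ i ∉ (bottomVertex k j).1.1 := by
      simp only [mem_bottomVertex]
      exact ⟨fun h => h.1 rfl, fun h => hpar h.2⟩
    have hj : j ∉ (bottomVertex k i).1.1 ∧ j ∉ (bottomVertex k j).1.1 := by
      simp only [mem_bottomVertex]
      exact ⟨fun h => hpar h.2.symm, fun h => h.1 rfl⟩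
    have hu' := eq_of_notMem_of_disjoint hd hij.ne hi hj ⟨hC1.1, hD1.1⟩
    have hv' := eq_of_notMem_of_disjoint hd hij.ne hi hj ⟨hvC, hvD⟩
    rcases hu' with hu' | hu' <;> rcases hv' with hv' | hv'
    · exact absurd (hu'.trans hv'.symm) huv
    · exact key _ _ hCD hC1.2 (by rw [hu']) (by rw [hv'])
    · exact Sym2.eq_swap.trans (key _ _ hCD.symm hD1.2 (by rw [hu']) (by rw [hv']))
    · exact absurd (hu'.trans hv'.symm) huv
  · obtain ⟨a, ha⟩ := hxy.2.2.1.exists_max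
    obtain ⟨b, hb⟩ := hxy.2.2.2.exists_max
    have hab := hxy.max_ne hCDne ha hb
    have ha' := ha.notMem hxy.1.left hxy.2.1.left
    have hb' := hb.notMem hxy.1.right hxy.2.1.right
    have hu' := eq_of_notMem_of_disjoint hd hab ha' hb' ⟨hC1.1, hD1.1⟩
    have hv' := eq_of_notMem_of_disjoint hd hab ha' hb' ⟨hvC, hvD⟩
    rcases hu' with rfl | rfl <;> rcases hv' with rfl | rfl
    · exact absurd rfl huv
    · exact h.edge_eq hu hv hxy ha hb
    · exact h.edge_eq hu hv hxy.swap hb ha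
    · exact absurd rfl huv

/-! ### Winding of three-colourings -/

/-- The signed step between two distinct colours out of three. -/
def colourStep (a b : Fin 3) : ℤ := if b = a + 1 then 1 else -1

theorem colourStep_cases (a b : Fin 3) : colourStep a b = 1 ∨ colourStep a b = -1 := by
  unfold colourStep
  split_ifs
  · exact Or.inl rfl
  · exact Or.inr rfl

theorem colourStep_swap : ∀ {a b : Fin 3}, a ≠ b → colourStep b a = -colourStep a b := by decide

/-- Four signs around a closed walk have an even sum divisible by 3 and of absolute value at most 4.
This is the discrete form of homotopy invariance. -/
theorem colourStep_four : ∀ {a b c d : Fin 3}, a ≠ b → b ≠ c → c ≠ d → d ≠ a →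
    colourStep a b + colourStep b c + colourStep c d + colourStep d a = 0 := by decide

theorem colourStep_three : ∀ {a b c d : Fin 3}, a ≠ b → b ≠ c → c ≠ d → a ≠ d →
    colourStep a b + colourStep b c + colourStep c d = 1 ∨
      colourStep a b + colourStep b c + colourStep c d = -1 := by decide

theorem three_dvd_colourStep : ∀ {a b : Fin 3}, a ≠ b →
    (3 : ℤ) ∣ colourStep a b - ((b.val : ℤ) - (a.val : ℤ)) := by decide

theorem sum_colourStep_emod_two (f g : ℕ → Fin 3) (m : ℕ) :
    (∑ i ∈ Finset.range m, colourStep (f i) (g i)) % 2 = (m : ℤ) % 2 := by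
  induction m with
  | zero => simp
  | succ m ih =>
    rw [Finset.sum_range_succ]
    have := colourStep_cases (f m) (g m)
    push_cast
    omega

theorem sum_range_shift {M : Type*} [AddCommGroup M] (f : ℕ → M) {n : ℕ} (h : f n = f 0) :
    ∑ i ∈ Finset.range n, f (i + 1) = ∑ i ∈ Finset.range n, f i := by
  have := Finset.sum_range_succ' f n
  rw [Finset.sum_range_succ, h] at this
  exact (add_right_cancel this).symm

theorem three_dvd_sum_colourStep (f : ℕ → Fin 3) {n : ℕ} (hf : ∀ i, f i ≠ f (i + 1))
    (h : f n = f 0) : (3 : ℤ) ∣ ∑ i ∈ Finset.range n, colourStep (f i) (f (i + 1)) := by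
  have h1 : (3 : ℤ) ∣ ∑ i ∈ Finset.range n, (colourStep (f i) (f (i + 1)) -
      (((f (i + 1)).val : ℤ) - ((f i).val : ℤ))) :=
    Finset.dvd_sum fun i _ => three_dvd_colourStep (hf i)
  rw [Finset.sum_sub_distrib, Finset.sum_range_sub (fun i => ((f i).val : ℤ)), h, sub_self,
    sub_zero] at h1
  exact h1

/-- The two rails of a ladder have the same count up to the contributions of the first and the last
rung, since each quadrilateral contributes 0. -/
theorem sum_colourStep_ladder (f : ℕ → Fin 3) {m : ℕ} (j : ℕ)
    (hf : ∀ i, f i ≠ f (i + 1)) (hm : ∀ i ≤ m, f i ≠ f (i + j)) :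
    ∑ i ∈ Finset.range m, colourStep (f (i + j)) (f (i + j + 1)) =
      ∑ i ∈ Finset.range m, colourStep (f i) (f (i + 1)) +
        colourStep (f m) (f (m + j)) - colourStep (f 0) (f j) := by
  induction m with
  | zero => simp
  | succ m ih =>
    rw [Finset.sum_range_succ, Finset.sum_range_succ, ih fun i hi => hm i (by omega)]
    have e : m + 1 + j = m + j + 1 := by omega
    have h1 := hm m (by omega)
    have h2 := hm (m + 1) le_rfl
    rw [e] at h2 ⊢
    have h4 := colourStep_four (hf m) h2 (hf (m + j)).symm h1.symm
    rw [colourStep_swap (hf (m + j)), colourStep_swap h1] at h4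
    linarith

/-- A three-colouring of a Möbius ladder winds around its rim an even number of times if the two
halves of the rim are odd, and an odd number of times if they are even. -/
theorem sum_colourStep_moebius (f : ℕ → Fin 3) (m : ℕ) (hf : ∀ i, f i ≠ f (i + 1))
    (hm : ∀ i, f i ≠ f (i + m)) (hp : ∀ i, f (i + 2 * m) = f i) :
    (∑ i ∈ Finset.range (2 * m), colourStep (f i) (f (i + 1))) % 4 = (2 * m + 2 : ℤ) % 4 := by
  rw [two_mul, Finset.sum_range_add]
  have h1 := sum_colourStep_ladder f (m := m) m hf fun i _ => hm i
  have h2 : f (m + m) = f 0 := by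
    have := hp 0
    rwa [zero_add, two_mul] at this
  have h0 := hm 0
  rw [zero_add] at h0
  -- The last rung is the first one reversed, so the halves of the rim differ by twice an odd
  -- number: the total is `2 * S - 2 * ε` with `S ≡ m` modulo 2 and `ε = ±1`.
  rw [h2, colourStep_swap h0] at h1
  have h3 := sum_colourStep_emod_two f (fun i => f (i + 1)) m
  have h4 := colourStep_cases (f 0) (f m)
  have e : ∀ x, m + x = x + m := fun x => add_comm _ _
  simp only [e]
  omega

/-- The rungs join the path 0, …, k to the path k, …, 2k, and the quadrilateral 0, k, 2k, 2k+1
closes the band. The total is `2 * S - 2 * ε` with `S` odd and `ε = ±1`. -/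
theorem sum_colourStep_odd_layer (f : ℕ → Fin 3) {k : ℕ} (hk : k % 2 = 1)
    (hf : ∀ i, f i ≠ f (i + 1)) (hm : ∀ i ≤ k, f i ≠ f (i + k))
    (hp : f (2 * k + 2) = f 0) :
    (∑ i ∈ Finset.range (2 * k + 2), colourStep (f i) (f (i + 1))) % 4 = 0 := by
  rw [Finset.sum_range_succ, Finset.sum_range_succ, two_mul, Finset.sum_range_add]
  have h1 := sum_colourStep_ladder f k hf hm
  have h0 := hm 0 (Nat.zero_le k)
  have hkk := hm k le_rfl
  have h3 := sum_colourStep_emod_two f (fun i => f (i + 1)) k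
  have h4 := colourStep_cases (f 0) (f k)
  have e : ∀ x, k + x = x + k := fun x => add_comm _ _
  rw [zero_add] at h0
  have a1 := hf (k + k)
  have a2 := hf (k + k + 1)
  have ep : f (k + k + 1 + 1) = f 0 := by rw [← hp, two_mul]
  rw [ep] at a2 ⊢
  have h5 := colourStep_four h0 hkk a1 a2
  have e' : ∑ x ∈ Finset.range k, colourStep (f (k + x)) (f (k + x + 1)) =
      ∑ x ∈ Finset.range k, colourStep (f (x + k)) (f (x + k + 1)) := by
    simp only [add_comm k]
  rw [e']
  omega

/-- A proper three-colouring `γ` of unordered pairs of points of opposite parity on a cycle of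
length `2k+2`, where pairs are joined if both points move by one step, winds an odd number of
times along each half of the boundary cycle formed by the pairs `{i,i+1}`. -/
theorem sum_colourStep_pairs {k : ℕ} (hk : 1 ≤ k) (γ : ℕ → ℕ → Fin 3)
    (hsymm : ∀ x y, (x + y) % 2 = 1 → γ x y = γ y x)
    (hper : ∀ x y, (x + y) % 2 = 1 → γ (x + (2 * k + 2)) y = γ x y)
    (hrot : ∀ x y, (x + y) % 2 = 1 → γ x y ≠ γ (x + 1) (y + 1))
    (hver : ∀ x d, d % 2 = 1 → d + 2 < 2 * k + 2 →
      γ (x + 1) (x + 1 + d) ≠ γ x (x + (d + 2))) :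
    (∑ i ∈ Finset.range (2 * k + 2), colourStep (γ i (i + 1)) (γ (i + 1) (i + 1 + 1))) % 4 = 2 := by
  set W : ℕ → ℤ := fun d =>
    ∑ i ∈ Finset.range (2 * k + 2), colourStep (γ i (i + d)) (γ (i + 1) (i + 1 + d)) with hW
  have hper2 : ∀ x y, (x + y) % 2 = 1 → γ (x + (2 * k + 2)) (y + (2 * k + 2)) = γ x y := by
    intro x y h
    rw [hper _ _ (by omega), hsymm _ _ (by omega), hper _ _ (by omega), hsymm _ _ (by omega)]
  have hperd : ∀ x d, d % 2 = 1 → γ (x + (2 * k + 2)) (x + (2 * k + 2) + d) = γ x (x + d) := by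
    intro x d hd
    rw [← hper2 x (x + d) (by omega)]
    congr 1
    omega
  have hrotd : ∀ x d, d % 2 = 1 → γ x (x + d) ≠ γ (x + 1) (x + 1 + d) := by
    intro x d hd
    have := hrot x (x + d) (by omega)
    rwa [show x + d + 1 = x + 1 + d by omega] at this
  -- The quadrilaterals between the levels of distance `d` and `d + 2` give equal counts. The rungs
  -- `u` telescope and cancel by periodicity.
  have hstep : ∀ d, d % 2 = 1 → d + 2 < 2 * k + 2 → W (d + 2) = W d := by
    intro d hd hdk
    set u : ℕ → ℤ := fun i => colourStep (γ (i + 1) (i + 1 + d)) (γ i (i + (d + 2))) with hu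
    have h1 : ∀ i, colourStep (γ (i + 1) (i + 1 + d)) (γ (i + 1 + 1) (i + 1 + 1 + d)) =
        colourStep (γ i (i + (d + 2))) (γ (i + 1) (i + 1 + (d + 2))) - (u (i + 1) - u i) := by
      intro i
      have a1 := hrotd (i + 1) d hd
      have a2 := hver (i + 1) d hd hdk
      have a3 := hrotd i (d + 2) (by omega)
      have a4 := hver i d hd hdk
      have := colourStep_four a1 a2 a3.symm a4.symm
      rw [colourStep_swap a3, colourStep_swap a4] at this
      simp only [hu]
      linarith
    have h2 := sum_range_shift
      (fun i => colourStep (γ i (i + d)) (γ (i + 1) (i + 1 + d))) (n := 2 * k + 2) (by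
        have e1 := hperd 0 d hd
        have e2 := hperd 1 d hd
        simp only [zero_add] at e1 ⊢
        rw [show 2 * k + 2 + 1 = 1 + (2 * k + 2) by omega, e1, e2])
    simp only [hW]
    rw [← h2, Finset.sum_congr rfl fun i _ => h1 i, Finset.sum_sub_distrib,
      Finset.sum_range_sub]
    have h3 : u (2 * k + 2) = u 0 := by
      have e1 := hperd 0 (d + 2) (by omega)
      have e2 := hperd 1 d hd
      simp only [hu, zero_add] at e1 ⊢
      rw [show 2 * k + 2 + 1 = 1 + (2 * k + 2) by omega, e1, e2]
    rw [h3, sub_self, sub_zero]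
  have hall : ∀ m, 2 * m + 1 < 2 * k + 2 → W (2 * m + 1) = W 1 := by
    intro m
    induction m with
    | zero => intro _; rfl
    | succ m ih =>
      intro h
      rw [← ih (by omega), ← hstep (2 * m + 1) (by omega) (by omega)]
      rfl
  change W 1 % 4 = 2
  rcases Nat.even_or_odd k with ⟨m, hm⟩ | ⟨m, hm⟩
  -- For even k the innermost level consists of antipodal pairs, each visited twice. The count is
  -- twice a sum of `k + 1` signs, and `k + 1` is odd.
  · rw [← hall m (by omega), show 2 * m + 1 = k + 1 by omega]
    have h1 : ∀ i, γ (k + 1 + i) (k + 1 + i + (k + 1)) = γ i (i + (k + 1)) := by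
      intro i
      rw [hsymm _ _ (by omega), show k + 1 + i + (k + 1) = i + (2 * k + 2) by omega,
        hper _ _ (by omega), add_comm i]
    have h2 : W (k + 1) = 2 * ∑ i ∈ Finset.range (k + 1),
        colourStep (γ i (i + (k + 1))) (γ (i + 1) (i + 1 + (k + 1))) := by
      simp only [hW]
      rw [show 2 * k + 2 = (k + 1) + (k + 1) by omega, Finset.sum_range_add, two_mul]
      congr 1
      refine Finset.sum_congr rfl fun i _ => ?_
      rw [h1, add_assoc (k + 1) i 1, h1]
    have h3 := sum_colourStep_emod_two (fun i => γ i (i + (k + 1)))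
      (fun i => γ (i + 1) (i + 1 + (k + 1))) (k + 1)
    rw [h2]
    push_cast at h3
    omega
  -- For odd k, moving both tokens of {i, i+k} outwards gives a pair at distance `k` along the other
  -- arc. So level `k` is the rim of a Möbius ladder with halves of even length `k + 1`.
  · rw [← hall m (by omega), show 2 * m + 1 = k by omega]
    have h1 := sum_colourStep_moebius (fun i => γ i (i + k)) (k + 1)
      (fun i => hrotd i k (by omega)) (by
        intro i
        have h2 := hver (i + 2 * k + 1) k (by omega) (by omega)
        rw [show i + 2 * k + 1 + 1 = i + (2 * k + 2) by omega, hperd i k (by omega),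
          hsymm (i + 2 * k + 1) _ (by omega),
          show i + 2 * k + 1 + (k + 2) = i + k + 1 + (2 * k + 2) by omega,
          hper _ _ (by omega)] at h2
        rwa [show i + (k + 1) + k = i + 2 * k + 1 by omega]) (fun i => hperd i k (by omega))
    have h2 : W k = ∑ i ∈ Finset.range (2 * (k + 1)),
        colourStep (γ i (i + k)) (γ (i + 1) (i + 1 + k)) := rfl
    rw [h2]
    push_cast at h1
    omega

/-! ### Y_k is not three-colourable -/

/-- The elements of the cycle of length `2k+2`, numbered periodically by the natural numbers. -/
def cyclePoint (k i : ℕ) : Fin (2 * k + 2) := Fin.ofNat (2 * k + 2) i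

theorem cyclePoint_val (k i : ℕ) : (cyclePoint k i).val = i % (2 * k + 2) := rfl

theorem cyclePoint_succ (k i : ℕ) : cyclePoint k (i + 1) = cyclePoint k i + 1 := by
  apply Fin.ext
  rw [Fin.val_add, cyclePoint_val, cyclePoint_val]
  simp [Nat.add_mod]

theorem cyclePoint_add_period (k i : ℕ) : cyclePoint k (i + (2 * k + 2)) = cyclePoint k i := by
  apply Fin.ext
  rw [cyclePoint_val, cyclePoint_val, Nat.add_mod_right]

theorem cyclePoint_fin {k : ℕ} (x : Fin (2 * k + 2)) : cyclePoint k x.val = x :=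
  Fin.ext (Nat.mod_eq_of_lt x.isLt)

theorem cyclePoint_mod_two (k i : ℕ) : (cyclePoint k i).val % 2 = i % 2 := by
  rw [cyclePoint_val]
  exact Nat.mod_mod_of_dvd i ⟨k + 1, by ring⟩

theorem oppParity_cyclePoint {k x y : ℕ} (h : (x + y) % 2 = 1) :
    OppParity (cyclePoint k x) (cyclePoint k y) := by
  unfold OppParity
  rw [cyclePoint_mod_two, cyclePoint_mod_two]
  omega

theorem cyclePoint_ne {k x d : ℕ} (h : 0 < d) (h' : d < 2 * k + 2) :
    cyclePoint k x ≠ cyclePoint k (x + d) := by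
  intro e
  have := congrArg Fin.val e
  rw [cyclePoint_val, cyclePoint_val] at this
  have h3 := (Nat.modEq_iff_dvd' (Nat.le_add_right x d)).1 this
  rw [Nat.add_sub_cancel_left] at h3
  exact absurd (Nat.le_of_dvd h h3) (by omega)

theorem exists_hasTokens_dist {k : ℕ} (m : ℕ) (hm : 2 * m + 1 < 2 * k + 2) (i : ℕ) :
    ∃ A : schrijverVertices (2 * k + 2) k,
      HasTokens A (cyclePoint k i) (cyclePoint k (i + (2 * m + 1))) := by
  induction m generalizing i with
  | zero => exact ⟨_, hasTokens_bottomVertex' k (cyclePoint_succ k i)⟩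
  | succ m ih =>
    obtain ⟨A, hA⟩ := ih (by omega) (i + 1)
    obtain ⟨B, hB, _⟩ := exists_tokenMove (p' := cyclePoint k i)
      (q' := cyclePoint k (i + (2 * (m + 1) + 1))) hA (Or.inr (cyclePoint_succ k i))
      (Or.inl (by rw [← cyclePoint_succ]; congr 1; omega)) (by
        rintro ⟨h, _⟩
        rw [show i + 1 + (2 * m + 1) = i + (2 * m + 2) by omega] at h
        exact cyclePoint_ne (by omega) (by omega) h)
    exact ⟨B, hB⟩

theorem exists_vertex_hasTokens {k : ℕ} {p q : Fin (2 * k + 2)} (h : OppParity p q) :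
    ∃ A : schrijverVertices (2 * k + 2) k, HasTokens A p q := by
  have key : ∀ {p q : Fin (2 * k + 2)}, OppParity p q → p.val < q.val →
      ∃ A : schrijverVertices (2 * k + 2) k, HasTokens A p q := by
    intro p q h hlt
    unfold OppParity at h
    have hq := q.isLt
    obtain ⟨A, hA⟩ := exists_hasTokens_dist (k := k) ((q.val - p.val) / 2) (by omega) p.val
    rw [show p.val + (2 * ((q.val - p.val) / 2) + 1) = q.val by omega, cyclePoint_fin,
      cyclePoint_fin] at hA
    exact ⟨A, hA⟩
  rcases Nat.lt_trichotomy p.val q.val with h1 | h1 | h1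
  · exact key h h1
  · exact absurd (congrArg (· % 2) h1) h
  · obtain ⟨A, hA⟩ := key h.symm h1
    exact ⟨A, hA.symm⟩

theorem bottomVertex_ne_succ {k : ℕ} (hk : 1 ≤ k) (i : Fin (2 * k + 2)) :
    bottomVertex k i ≠ bottomVertex k (i + 1) := by
  intro h
  have h1 := bottomVertex_injective hk h
  exact oppParity_succ i (by rw [← h1])

/-- A three-colouring that is proper on the edges along which both tokens move winds an odd number
of times along each half of the cycle formed by the vertices `V_j`. -/
theorem sum_colourStep_bottom {k : ℕ} (hk : 1 ≤ k) (c : schrijverVertices (2 * k + 2) k → Fin 3)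
    (hc : ∀ A B p q p' q', TokenMove A B p q p' q' → A ≠ B → c A ≠ c B) :
    (∑ i ∈ Finset.range (2 * k + 2), colourStep (c (bottomVertex k (cyclePoint k i)))
      (c (bottomVertex k (cyclePoint k (i + 1))))) % 4 = 2 := by
  have hex : ∀ x y : ℕ, ∃ A : schrijverVertices (2 * k + 2) k, (x + y) % 2 = 1 →
      HasTokens A (cyclePoint k x) (cyclePoint k y) := by
    intro x y
    by_cases h : (x + y) % 2 = 1
    · obtain ⟨A, hA⟩ := exists_vertex_hasTokens (oppParity_cyclePoint (k := k) h)
      exact ⟨A, fun _ => hA⟩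
    -- Arbitrary value: pairs of equal parity carry no vertex.
    · exact ⟨bottomVertex k 0, fun h' => absurd h' h⟩
  choose v hv using hex
  have hne : ∀ {x y x' y' : ℕ}, (x + y) % 2 = 1 → (x' + y') % 2 = 1 →
      cyclePoint k x' ≠ cyclePoint k x → cyclePoint k x' ≠ cyclePoint k y →
      v x y ≠ v x' y' := by
    intro x y x' y' h h' h1 h2 e
    have h3 := hv x y h
    rw [e] at h3
    rcases h3.unique (hv x' y' h') with h4 | h4
    · exact h1 h4.1
    · exact h2 h4.1
  have hb : ∀ i, v i (i + 1) = bottomVertex k (cyclePoint k (i + 1)) := fun i =>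
    (hv i (i + 1) (by omega)).eq (hasTokens_bottomVertex' k (cyclePoint_succ k i))
  have main := sum_colourStep_pairs hk (fun x y => c (v x y))
    (fun x y h => congrArg c ((hv x y h).eq (hv y x (by omega)).symm))
    (fun x y h => congrArg c (by
      have := hv (x + (2 * k + 2)) y (by omega)
      rw [cyclePoint_add_period] at this
      exact this.eq (hv x y h)))
    (fun x y h => by
      have h1 := hv x y h
      have h2 := hv (x + 1) (y + 1) (by omega)
      have hm : TokenMove (v x y) (v (x + 1) (y + 1)) _ _ _ _ :=
        ⟨h1, h2, Or.inl (cyclePoint_succ k x), Or.inl (cyclePoint_succ k y)⟩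
      refine hc _ _ _ _ _ _ hm fun e => ?_
      rw [← e] at h2
      have e0 : cyclePoint k x ≠ cyclePoint k (x + 1) := cyclePoint_ne one_pos (by omega)
      rcases h1.unique h2 with ⟨h3, _⟩ | ⟨h3, h4⟩
      · exact e0 h3.symm
      · rw [cyclePoint_succ, ← h3, ← cyclePoint_succ] at h4
        exact (cyclePoint_ne (k := k) (x := x) (d := 2) (by omega) (by omega) h4.symm).elim)
    (fun x d hd hdk => by
      have h1 := hv (x + 1) (x + 1 + d) (by omega)
      have h2 := hv x (x + (d + 2)) (by omega)
      refine hc _ _ _ _ _ _ (⟨h1, h2, Or.inr (cyclePoint_succ k x), Or.inl ?_⟩ :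
        TokenMove _ _ _ _ _ _) (hne (by omega) (by omega) ?_ ?_)
      · rw [← cyclePoint_succ]
        congr 1
        omega
      · exact cyclePoint_ne one_pos (by omega)
      · rw [add_assoc]
        exact cyclePoint_ne (by omega) (by omega))
  have hper : bottomVertex k (cyclePoint k (2 * k + 2)) = bottomVertex k (cyclePoint k 0) := by
    rw [← cyclePoint_add_period k 0, zero_add]
  have hper1 : bottomVertex k (cyclePoint k (2 * k + 2 + 1)) =
      bottomVertex k (cyclePoint k (0 + 1)) := by
    rw [← cyclePoint_add_period k (0 + 1)]
    congr 2
    omega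
  -- The pair {i, i+1} is V_{i+1}, so the count over pairs is that over the V_i shifted by one.
  have hsh := sum_range_shift (fun i => colourStep (c (bottomVertex k (cyclePoint k i)))
      (c (bottomVertex k (cyclePoint k (i + 1))))) (n := 2 * k + 2) (by rw [hper, hper1])
  rw [← hsh]
  simp only [hb] at main
  exact main

theorem bottom_colours_ne {k : ℕ} (hk : 1 ≤ k) (c : schrijverVertices (2 * k + 2) k → Fin 3)
    (hc : ∀ A B p q p' q', TokenMove A B p q p' q' → A ≠ B → c A ≠ c B) (i : ℕ) :
    c (bottomVertex k (cyclePoint k i)) ≠ c (bottomVertex k (cyclePoint k (i + 1))) := by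
  obtain ⟨p, p', hm⟩ := TokenStep.tokenMove_bottom
    (Or.inl (cyclePoint_succ k i) : TokenStep (cyclePoint k i) (cyclePoint k (i + 1)))
  refine hc _ _ _ _ _ _ hm ?_
  rw [cyclePoint_succ]
  exact bottomVertex_ne_succ hk _

theorem cyclePoint_self {k : ℕ} {i : ℕ} (h : i < 2 * k + 2) : (cyclePoint k i).val = i :=
  Nat.mod_eq_of_lt h

/-- The two Möbius bands give the counts 2 and 0 modulo 4 for their common boundary. -/
theorem kleinGraph_not_colorable {k : ℕ} (hk : 2 ≤ k) : ¬ (kleinGraph k).Colorable 3 := by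
  rintro ⟨C⟩
  have hc : ∀ A B p q p' q', TokenMove A B p q p' q' → A ≠ B → C A ≠ C B :=
    fun A B p q p' q' h hne => C.valid (h.adj_klein hk hne)
  have hb : ∀ i j, (layerGraph k).Adj i j → C (bottomVertex k i) ≠ C (bottomVertex k j) :=
    fun i j h => C.valid ((kleinGraph_adj_bottomVertex (by omega)).2 h)
  have hW := sum_colourStep_bottom (by omega) C hc
  have hstep := bottom_colours_ne (by omega) C hc
  have hper : ∀ i, C (bottomVertex k (cyclePoint k (i + (2 * k + 2)))) =
      C (bottomVertex k (cyclePoint k i)) := fun i => by rw [cyclePoint_add_period]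
  rcases Nat.even_or_odd k with he | ho
  · have h1 := sum_colourStep_moebius (fun i => C (bottomVertex k (cyclePoint k i))) (k + 1)
      hstep (by
        intro i
        apply hb
        rw [layerGraph_adj]
        refine Or.inr ⟨cyclePoint_ne (by omega) (by omega), ?_⟩
        rw [if_pos he, cyclePoint_val, cyclePoint_val]
        have h2 := Nat.mod_lt i (show 2 * k + 2 > 0 by omega)
        rw [Nat.add_mod, Nat.mod_eq_of_lt (show k + 1 < 2 * k + 2 by omega)]
        rcases Nat.lt_or_ge (i % (2 * k + 2)) (k + 1) with h3 | h3
        · left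
          have h4 := Nat.mod_eq_of_lt (show i % (2 * k + 2) + (k + 1) < 2 * k + 2 by omega)
          omega
        · right
          have h4 := Nat.mod_eq_sub_mod (show i % (2 * k + 2) + (k + 1) ≥ 2 * k + 2 by omega)
          have h5 := Nat.mod_eq_of_lt
            (show i % (2 * k + 2) + (k + 1) - (2 * k + 2) < 2 * k + 2 by omega)
          omega) hper
    obtain ⟨m, rfl⟩ := he
    rw [show 2 * (m + m + 1) = 2 * (m + m) + 2 by ring] at h1
    push_cast at h1
    omega
  · have h1 := sum_colourStep_odd_layer (fun i => C (bottomVertex k (cyclePoint k i)))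
      (k := k) (Nat.odd_iff.1 ho) hstep (by
        intro i hi
        apply hb
        rw [layerGraph_adj]
        refine Or.inr ⟨cyclePoint_ne (by omega) (by omega), Or.inl ?_⟩
        rw [if_neg (Nat.not_even_iff_odd.2 ho), cyclePoint_self (by omega),
          cyclePoint_self (by omega)]
        omega) (by simpa using hper 0)
    omega

/-- For `k = 3`, three edges `{i,i+3}` of the bottom layer without a common element in their arcs
exclude a three-colouring. -/
theorem no_colouring_three {c : schrijverVertices (2 * 3 + 2) 3 → Fin 3}
    (hc : ∀ A B p q p' q', TokenMove A B p q p' q' → A ≠ B → c A ≠ c B)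
    (h0 : c (bottomVertex 3 0) ≠ c (bottomVertex 3 3))
    (h1 : c (bottomVertex 3 3) ≠ c (bottomVertex 3 6)) : False := by
  have hW := sum_colourStep_bottom (by omega) c hc
  have hstep := bottom_colours_ne (by omega) c hc
  have h3 := three_dvd_sum_colourStep (fun i => c (bottomVertex 3 (cyclePoint 3 i))) (n := 8) hstep
    rfl
  -- Each of the arcs 0–3 and 3–6 contributes ±1, since its ends differ in colour; with the two
  -- remaining steps the total is at most 4 in absolute value.
  have t0 := colourStep_three (hstep 0) (hstep 1) (hstep 2) h0
  have t1 := colourStep_three (hstep 3) (hstep 4) (hstep 5) h1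
  have d6 := colourStep_cases (c (bottomVertex 3 (cyclePoint 3 6)))
    (c (bottomVertex 3 (cyclePoint 3 (6 + 1))))
  have d7 := colourStep_cases (c (bottomVertex 3 (cyclePoint 3 7)))
    (c (bottomVertex 3 (cyclePoint 3 (7 + 1))))
  simp only [Finset.sum_range_succ, Finset.sum_range_zero, Nat.reduceMul, Nat.reduceAdd,
    zero_add] at hW h3 t0 t1 d6 d7
  omega

/-! ### Colour patterns after deleting an extra edge -/

/-- The sequence `0, 1, 2, 0, 2, 0, 2, …`, whose residues modulo `3` change by one. -/
def zigzag (t : ℕ) : ℕ := if t = 0 then 0 else if t = 1 then 1 else if t % 2 = 0 then 2 else 0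

/-- The sequence `0, 1, 2, 1, 2, 1, 2, …`. -/
def zigzag' (t : ℕ) : ℕ := if t = 0 then 0 else if t % 2 = 0 then 2 else 1

/-- Colours of the vertices `V_i` when the edge `{j,j+k}` is deleted, `0 < j < k`, `k` odd. -/
def innerColour (k j i : ℕ) : ℕ :=
  if i < j then zigzag i else if i = j then zigzag (j - 1) + 2 else if i ≤ k then zigzag (i - 2) + 1
  else if i < k + j then zigzag (i - k) + 1 else if i = k + j then zigzag (j - 1) + 2
  else if i ≤ 2 * k then zigzag (i - k - 2) else 1

/-- Colours of the other vertices that go with `innerColour`. -/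
def innerColour' (k j i : ℕ) : ℕ :=
  innerColour k j i + if j ≤ i ∧ i ≤ k + j then 1 else 2

/-- Colours of the vertices `V_i` when the edge `{0,k}` is deleted, `k` odd. -/
def endColour (k i : ℕ) : ℕ :=
  if i = 0 then 0 else if i ≤ k then zigzag' (i - 1) + 1
  else if i ≤ 2 * k then zigzag' (i - k - 1) + 2 else 2

/-- Colours of the other vertices that go with `endColour`. -/
def endColour' (k i : ℕ) : ℕ := endColour k i + if i ≤ k then 2 else 1

/-- Colours of the vertices `V_i` when the edge `{0,k+1}` is deleted, `k` even. -/
def evenColour (k i : ℕ) : ℕ :=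
  if i = 0 ∨ i = k + 1 then 0 else if i ≤ k then zigzag (i - 1) + 1 else zigzag (i - k - 2) + 2

/-- Colours of the other vertices that go with `evenColour`. -/
def evenColour' (k i : ℕ) : ℕ :=
  if i = 0 ∨ i = k + 1 then 1 else if i ≤ k then zigzag (i - 1) else zigzag (i - k - 2)

/-- The sequences `H` and `G` have the properties needed to colour the vertices `V_i` by `H` and
the vertices with more distant tokens by `G`, except for the extra edge `{j,j+k}`. -/
structure OddSeq (k j : ℕ) (H G : ℕ → ℕ) : Prop where
  step : ∀ i ≤ 2 * k, H i % 3 ≠ H (i + 1) % 3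
  last : H (2 * k + 1) % 3 ≠ H 0 % 3
  step' : ∀ i ≤ 2 * k, G i % 3 ≠ G (i + 1) % 3
  last' : G (2 * k + 1) % 3 ≠ G 0 % 3
  mixed : ∀ i ≤ 2 * k + 1, H i % 3 ≠ G i % 3
  opposite : ∀ i ≤ k, G i % 3 ≠ G (i + (k + 1)) % 3
  chord : ∀ i ≤ k, i ≠ j → H i % 3 ≠ H (i + k) % 3

/-- Modulo 3, the colour changes by +1 from `i` to `i + k` for `i < j` and by -1 for `i > j`; the
sign flips at the deleted edge, whose ends agree. For `k = 3` no such sequences exist, by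
`no_colouring_three`. -/
theorem oddSeq_inner {k j : ℕ} (hk : 5 ≤ k) (ho : k % 2 = 1) (hj : 0 < j) (hjk : j < k) :
    OddSeq k j (innerColour k j) (innerColour' k j) := by
  constructor
  · intro i hi
    unfold innerColour zigzag
    grind (splits := 40)
  · unfold innerColour zigzag
    grind (splits := 40)
  · intro i hi
    unfold innerColour' innerColour zigzag
    grind (splits := 40)
  · unfold innerColour' innerColour zigzag
    grind (splits := 40)
  · intro i hi
    unfold innerColour'
    grind (splits := 40)
  · intro i hi
    unfold innerColour' innerColour zigzag
    grind (splits := 40)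
  · intro i hi hij
    unfold innerColour zigzag
    grind (splits := 40)

/-- On every remaining extra edge the colour changes by +1 from `i` to `i + k`. The ends 0 and `k`
of the deleted edge agree because `k - 1` is even and positive. -/
theorem oddSeq_end {k : ℕ} (hk : 3 ≤ k) (ho : k % 2 = 1) :
    OddSeq k 0 (endColour k) (endColour' k) := by
  constructor
  · intro i hi
    unfold endColour zigzag'
    grind (splits := 40)
  · unfold endColour zigzag'
    grind (splits := 40)
  · intro i hi
    unfold endColour' endColour zigzag'
    grind (splits := 40)
  · unfold endColour' endColour zigzag'
    grind (splits := 40)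
  · intro i hi
    unfold endColour'
    grind (splits := 40)
  · intro i hi
    unfold endColour' endColour zigzag'
    grind (splits := 40)
  · intro i hi hij
    unfold endColour zigzag'
    grind (splits := 40)

/-! ### From colour patterns to colourings of Y_k minus an edge -/

theorem cyclePoint_add (k a b : ℕ) : cyclePoint k (a + b) = cyclePoint k a + cyclePoint k b := by
  apply Fin.ext
  rw [Fin.val_add, cyclePoint_val, cyclePoint_val, cyclePoint_val, Nat.add_mod]

theorem cyclePoint_val_cases {k i : ℕ} (h : i < 2 * (2 * k + 2)) :
    (cyclePoint k i).val = i ∧ i < 2 * k + 2 ∨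
      (cyclePoint k i).val + (2 * k + 2) = i ∧ 2 * k + 2 ≤ i := by
  rw [cyclePoint_val]
  rcases Nat.lt_or_ge i (2 * k + 2) with h1 | h1
  · exact Or.inl ⟨Nat.mod_eq_of_lt h1, h1⟩
  · have h2 := Nat.mod_eq_sub_mod h1
    have h3 := Nat.mod_eq_of_lt (show i - (2 * k + 2) < 2 * k + 2 by omega)
    omega

/-- Colours `c` for the vertices `V_i` and `g` for the other ones that fit together. -/
structure LayerColours (k : ℕ) (c g : Fin (2 * k + 2) → Fin 3) : Prop where
  step : ∀ i, c i ≠ c (i + 1)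
  step' : ∀ i, g i ≠ g (i + 1)
  mixed : ∀ i, c i ≠ g i
  even : k % 2 = 0 → ∀ i, g (i + cyclePoint k (k + 1)) = g i
  odd : k % 2 = 1 → ∀ i, g (i + cyclePoint k (k + 1)) ≠ g i

theorem exists_short_tokens {k : ℕ} (A : schrijverVertices (2 * k + 2) k) :
    ∃ x d, x < 2 * k + 2 ∧ d % 2 = 1 ∧ d ≤ k + 1 ∧
      HasTokens A (cyclePoint k x) (cyclePoint k (x + d)) := by
  have key : ∀ p q : Fin (2 * k + 2), HasTokens A p q → p.val < q.val →
      ∃ x d, x < 2 * k + 2 ∧ d % 2 = 1 ∧ d ≤ k + 1 ∧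
        HasTokens A (cyclePoint k x) (cyclePoint k (x + d)) := by
    intro p q h hlt
    have hp := p.isLt
    have hq := q.isLt
    have hpar := h.1
    unfold OppParity at hpar
    by_cases hs : q.val - p.val ≤ k + 1
    · refine ⟨p.val, q.val - p.val, hp, by omega, hs, ?_⟩
      rw [Nat.add_sub_cancel' hlt.le, cyclePoint_fin, cyclePoint_fin]
      exact h
    · refine ⟨q.val, p.val + (2 * k + 2) - q.val, hq, by omega, by omega, ?_⟩
      rw [Nat.add_sub_cancel' (by omega), cyclePoint_add_period, cyclePoint_fin, cyclePoint_fin]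
      exact h.symm
  obtain ⟨p, q, h⟩ := exists_hasTokens A
  rcases Nat.lt_trichotomy p.val q.val with h1 | h1 | h1
  · exact key p q h h1
  · exact absurd (congrArg (· % 2) h1) h.1
  · exact key q p h.symm h1

theorem TokenStep.ne_of_step {k : ℕ} {α : Type*} {c : Fin (2 * k + 2) → α}
    (hc : ∀ i, c i ≠ c (i + 1)) {a b : Fin (2 * k + 2)} (h : TokenStep a b) : c a ≠ c b := by
  rcases h with rfl | rfl
  · exact hc a
  · exact (hc b).symm

theorem TokenStep.add_right {k : ℕ} {a b : Fin (2 * k + 2)} (h : TokenStep a b)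
    (t : Fin (2 * k + 2)) : TokenStep (a + t) (b + t) := by
  rcases h with rfl | rfl
  · exact Or.inl (add_right_comm _ _ _)
  · exact Or.inr (add_right_comm _ _ _)

theorem tokenStep_aligned {k x d y e : ℕ} (hk : 3 ≤ k) (hx : x < 2 * k + 2)
    (hy : y < 2 * k + 2) (hd' : d ≤ k + 1) (he' : e ≤ k + 1)
    (h1 : TokenStep (cyclePoint k x) (cyclePoint k y))
    (h2 : TokenStep (cyclePoint k (x + d)) (cyclePoint k (y + e))) :
    d = e ∨ (e = d + 2 ∧ cyclePoint k x = cyclePoint k y + 1) ∨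
      (d = e + 2 ∧ cyclePoint k y = cyclePoint k x + 1) := by
  have a1 := fin_val_succ (cyclePoint k x)
  have a2 := fin_val_succ (cyclePoint k y)
  have a3 := fin_val_succ (cyclePoint k (x + d))
  have a4 := fin_val_succ (cyclePoint k (y + e))
  have b1 := cyclePoint_self hx
  have b2 := cyclePoint_self hy
  have b3 := cyclePoint_val_cases (show x + d < 2 * (2 * k + 2) by omega)
  have b4 := cyclePoint_val_cases (show y + e < 2 * (2 * k + 2) by omega)
  unfold TokenStep at h1 h2
  rcases h1 with h1 | h1 <;> rcases h2 with h2 | h2 <;>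
    simp only [h1, and_true] <;>
    (simp only [Fin.ext_iff] at h1 h2 ⊢; omega)

theorem tokenStep_cyclePoint {k a b : ℕ} (ha : a < 3 * k + 3) (hb : b < 3 * k + 3) :
    TokenStep (cyclePoint k a) (cyclePoint k b) ↔ b = a + 1 ∨ b + (2 * k + 2) = a + 1 ∨
      b = a + 1 + (2 * k + 2) ∨ a = b + 1 ∨ a + (2 * k + 2) = b + 1 ∨
      a = b + 1 + (2 * k + 2) := by
  have a1 := fin_val_succ (cyclePoint k a)
  have a2 := fin_val_succ (cyclePoint k b)
  have b1 := cyclePoint_val_cases (show a < 2 * (2 * k + 2) by omega)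
  have b2 := cyclePoint_val_cases (show b < 2 * (2 * k + 2) by omega)
  unfold TokenStep
  simp only [Fin.ext_iff]
  omega

/-- The case where a move changes which token starts the short arc. Apart from a vertex compared
with itself, this happens only at the innermost levels, where the arcs nearly fill the cycle. -/
theorem tokenStep_crossed {k x d y e : ℕ} (hk : 3 ≤ k) (hx : x < 2 * k + 2)
    (hy : y < 2 * k + 2) (hd : d % 2 = 1) (he : e % 2 = 1) (hd' : d ≤ k + 1) (he' : e ≤ k + 1)
    (h1 : TokenStep (cyclePoint k x) (cyclePoint k (y + e)))
    (h2 : TokenStep (cyclePoint k (x + d)) (cyclePoint k y)) :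
    (d = 1 ∧ e = 1 ∧ x = y) ∨
      (3 ≤ d ∧ 3 ≤ e ∧
        (k % 2 = 0 → TokenStep (cyclePoint k (x + (k + 1))) (cyclePoint k y)) ∧
        (k % 2 = 1 → cyclePoint k y = cyclePoint k (x + (k + 1)))) := by
  rw [tokenStep_cyclePoint (by omega) (by omega)] at h1 h2
  have hsum : d + e = 2 ∧ x = y ∨ d + e + 2 = 2 * k + 2 ∨ d + e = 2 * k + 2 := by omega
  rcases hsum with hsum | hsum
  · left; omega
  right
  refine ⟨by omega, by omega, fun hk2 => ?_, fun hk2 => ?_⟩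
  · rw [tokenStep_cyclePoint (by omega) (by omega)]
    have : d = k + 1 ∨ e = k + 1 := by omega
    omega
  · have hdk : d = k := by omega
    have hek : e = k := by omega
    have : y = x + (k + 1) ∨ y + (2 * k + 2) = x + (k + 1) := by omega
    rcases this with h | h
    · rw [h]
    · rw [← h, cyclePoint_add_period]

theorem LayerColours.exists_colouring {k : ℕ} (hk : 3 ≤ k) {c g : Fin (2 * k + 2) → Fin 3}
    (h : LayerColours k c g) : ∃ f : schrijverVertices (2 * k + 2) k → Fin 3,
      (∀ i, f (bottomVertex k i) = c i) ∧
        ∀ A B p q p' q', TokenMove A B p q p' q' → A ≠ B → f A ≠ f B := by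
  choose x d hx hd hdk ht using fun A : schrijverVertices (2 * k + 2) k => exists_short_tokens A
  -- The colour depends only on the start `x` of the short arc and on whether `A` is a bottom
  -- vertex. Widening V_{x+1} moves the start to `x - 1`, so the offsets 1 and 2 make that edge
  -- compare `c` and `g` at the same index.
  refine ⟨fun A => if d A = 1 then c (cyclePoint k (x A) + 1) else g (cyclePoint k (x A) + 1 + 1),
    fun i => ?_, fun A B p q p' q' hm hne => ?_⟩
  · obtain ⟨r, rfl⟩ := exists_eq_succ i
    dsimp only
    have h1 := ht (bottomVertex k (r + 1))
    have h2 := hx (bottomVertex k (r + 1))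
    have h3 := hdk (bottomVertex k (r + 1))
    generalize x (bottomVertex k (r + 1)) = y at *
    generalize d (bottomVertex k (r + 1)) = e at *
    have a1 := fin_val_succ r
    have b1 := cyclePoint_self h2
    have b2 := cyclePoint_val_cases (show y + e < 2 * (2 * k + 2) by omega)
    rcases (hasTokens_bottomVertex k r).unique h1 with ⟨h4, h5⟩ | ⟨h4, h5⟩
    · have : e = 1 := by
        rw [Fin.ext_iff] at h4 h5
        omega
      simp only [this, if_true, h4]
    · exfalso
      rw [Fin.ext_iff] at h4 h5
      omega
  · dsimp only
    have hA := ht A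
    have hB := ht B
    have hxA := hx A
    have hxB := hx B
    have hdA := hd A
    have hdB := hd B
    have hdA' := hdk A
    have hdB' := hdk B
    have hcase : (TokenStep (cyclePoint k (x A)) (cyclePoint k (x B)) ∧
        TokenStep (cyclePoint k (x A + d A)) (cyclePoint k (x B + d B))) ∨
        (TokenStep (cyclePoint k (x A)) (cyclePoint k (x B + d B)) ∧
        TokenStep (cyclePoint k (x A + d A)) (cyclePoint k (x B))) := by
      obtain ⟨h1, h2, h3, h4⟩ := hm
      rcases h1.unique hA with ⟨e1, e2⟩ | ⟨e1, e2⟩ <;>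
        rcases h2.unique hB with ⟨e3, e4⟩ | ⟨e3, e4⟩ <;> rw [e1, e2, e3, e4] <;> tauto
    have hAB : ¬ (d A = 1 ∧ d B = 1 ∧ x A = x B) := by
      rintro ⟨h1, h2, h3⟩
      rw [h1, h3] at hA
      rw [h2] at hB
      exact hne (hA.eq hB)
    generalize x A = a at *
    generalize x B = b at *
    generalize d A = m at *
    generalize d B = n at *
    rcases hcase with ⟨h1, h2⟩ | ⟨h1, h2⟩
    · have hstep := (h1.add_right 1)
      have hstep' := (hstep.add_right 1)
      rcases tokenStep_aligned hk hxA hxB hdA' hdB' h1 h2 with rfl | ⟨h3, h4⟩ | ⟨h3, h4⟩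
      · split_ifs
        · exact hstep.ne_of_step h.step
        · exact hstep'.ne_of_step h.step'
      · rw [if_neg (show n ≠ 1 by omega), h4]
        split_ifs
        · exact h.mixed _
        · exact (h.step' _).symm
      · rw [if_neg (show m ≠ 1 by omega), h4]
        split_ifs
        · exact (h.mixed _).symm
        · exact h.step' _
    · rcases tokenStep_crossed hk hxA hxB hdA hdB hdA' hdB' h1 h2 with h3 | ⟨h3, h4, h5, h6⟩
      · exact (hAB h3).elim
      · rw [if_neg (by omega), if_neg (by omega)]
        have hsh : g (cyclePoint k (a + (k + 1)) + 1 + 1) =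
            g (cyclePoint k a + 1 + 1 + cyclePoint k (k + 1)) := by
          rw [cyclePoint_add]
          exact congrArg g (by abel)
        rcases Nat.mod_two_eq_zero_or_one k with hk2 | hk2
        · rw [← h.even hk2, ← hsh]
          exact (((h5 hk2).add_right 1).add_right 1).ne_of_step h.step'
        · rw [h6 hk2, hsh]
          exact (h.odd hk2 _).symm

/-- Colours as in `LayerColours` that agree on a single edge of the bottom layer show that the
deletion of this edge leaves a three-colourable graph. -/
theorem LayerColours.exists_colouring_delete {k : ℕ} (hk : 3 ≤ k)
    {c g : Fin (2 * k + 2) → Fin 3} (h : LayerColours k c g) {a b : Fin (2 * k + 2)}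
    (hc : ∀ i j, (layerGraph k).Adj i j → c i = c j → s(i, j) = s(a, b)) :
    ∃ f : schrijverVertices (2 * k + 2) k → Fin 3, ∀ A B, (kleinGraph k).Adj A B → f A = f B →
      s(A, B) = s(bottomVertex k a, bottomVertex k b) := by
  obtain ⟨f, hf, hm⟩ := h.exists_colouring hk
  refine ⟨f, fun A B hAB he => ?_⟩
  rcases kleinGraph_cases hAB with ⟨i, j, rfl, rfl, hij, _⟩ | ⟨p, q, p', q', h'⟩
  · rw [hf, hf] at he
    exact congrArg (Sym2.map (bottomVertex k)) (hc i j hij he)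
  · exact absurd he (hm _ _ _ _ _ _ h' hAB.ne)

theorem fin_three_ne {m n : ℕ} : Fin.ofNat 3 m ≠ Fin.ofNat 3 n ↔ m % 3 ≠ n % 3 := by
  rw [ne_eq, Fin.ext_iff]
  rfl

theorem fin_three_eq {m n : ℕ} : Fin.ofNat 3 m = Fin.ofNat 3 n ↔ m % 3 = n % 3 := by
  rw [Fin.ext_iff]
  rfl

theorem fin_val_add_half {k : ℕ} (i : Fin (2 * k + 2)) :
    (i + cyclePoint k (k + 1)).val = i.val + (k + 1) ∧ i.val ≤ k ∨
      (i + cyclePoint k (k + 1)).val + (k + 1) = i.val ∧ k < i.val := by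
  have hi := i.isLt
  have h := cyclePoint_val_cases (k := k) (show i.val + (k + 1) < 2 * (2 * k + 2) by omega)
  rw [cyclePoint_add, cyclePoint_fin] at h
  omega

theorem OddSeq.layerColours {k j : ℕ} {H G : ℕ → ℕ} (hk : k % 2 = 1) (h : OddSeq k j H G) :
    LayerColours k (fun i => Fin.ofNat 3 (H i.val)) (fun i => Fin.ofNat 3 (G i.val)) := by
  constructor
  · intro i
    rw [fin_three_ne]
    rcases fin_val_succ i with ⟨h1, h2⟩ | ⟨h1, h2⟩
    · rw [h1]
      exact h.step _ (by omega)
    · rw [h1, h2]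
      exact h.last
  · intro i
    rw [fin_three_ne]
    rcases fin_val_succ i with ⟨h1, h2⟩ | ⟨h1, h2⟩
    · rw [h1]
      exact h.step' _ (by omega)
    · rw [h1, h2]
      exact h.last'
  · intro i
    rw [fin_three_ne]
    exact h.mixed _ (by omega)
  · omega
  · intro _ i
    rw [fin_three_ne]
    rcases fin_val_add_half i with ⟨h1, h2⟩ | ⟨h1, h2⟩
    · rw [h1]
      exact (h.opposite _ h2).symm
    · rw [← h1]
      exact h.opposite _ (by omega)

theorem OddSeq.exists_colouring {k j : ℕ} {H G : ℕ → ℕ} (hk : 3 ≤ k) (ho : k % 2 = 1)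
    (h : OddSeq k j H G) :
    ∃ f : schrijverVertices (2 * k + 2) k → Fin 3, ∀ A B, (kleinGraph k).Adj A B → f A = f B →
      s(A, B) = s(bottomVertex k (cyclePoint k j), bottomVertex k (cyclePoint k (j + k))) := by
  have hl := h.layerColours ho
  refine hl.exists_colouring_delete hk fun a b hab he => ?_
  have key : ∀ a b : Fin (2 * k + 2), a.val ≤ k → b.val = a.val + k →
      (Fin.ofNat 3 (H a.val) = Fin.ofNat 3 (H b.val)) →
      s(a, b) = s(cyclePoint k j, cyclePoint k (j + k)) := by
    intro a b ha hb he
    have : a.val = j := by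
      by_contra hne
      rw [hb] at he
      exact h.chord _ ha hne (fin_three_eq.1 he)
    rw [← this, ← hb, cyclePoint_fin, cyclePoint_fin]
  rcases layerGraph_adj.1 hab with hs | ⟨_, hs⟩
  · exact absurd he (hs.ne_of_step hl.step)
  · rw [if_neg (by rw [Nat.not_even_iff_odd]; exact Nat.odd_iff.2 ho)] at hs
    rcases hs with ⟨h1, h2⟩ | ⟨h1, h2⟩
    · exact key a b h1 h2 he
    · rw [Sym2.eq_swap]
      exact key b a h1 h2 he.symm

/-- The reflection `i ↦ 2k - i` of the cycle of length `2k+2`. -/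
def reflectIndex (k i : ℕ) : ℕ := if i ≤ 2 * k then 2 * k - i else 2 * k + 1

/-- For odd k the reflection preserves L_k and exchanges the extra edges {0,k} and {k,2k}. -/
theorem OddSeq.reflect {k : ℕ} {H G : ℕ → ℕ} (hk : 3 ≤ k) (h : OddSeq k 0 H G) :
    OddSeq k k (fun i => H (reflectIndex k i)) (fun i => G (reflectIndex k i)) := by
  have r1 : ∀ i ≤ 2 * k, reflectIndex k i = 2 * k - i := fun i hi => if_pos hi
  have r2 : reflectIndex k (2 * k + 1) = 2 * k + 1 := if_neg (by omega)
  have rstep : ∀ F : ℕ → ℕ, (∀ i ≤ 2 * k, F i % 3 ≠ F (i + 1) % 3) →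
      (F (2 * k + 1) % 3 ≠ F 0 % 3) →
      ∀ i ≤ 2 * k, F (reflectIndex k i) % 3 ≠ F (reflectIndex k (i + 1)) % 3 := by
    intro F hF hF' i hi
    rcases Nat.lt_or_ge i (2 * k) with h1 | h1
    · rw [r1 i hi, r1 (i + 1) (by omega)]
      have := hF (2 * k - (i + 1)) (by omega)
      rw [show 2 * k - (i + 1) + 1 = 2 * k - i by omega] at this
      exact this.symm
    · obtain rfl : i = 2 * k := by omega
      rw [r1 _ le_rfl, r2, Nat.sub_self]
      exact hF'.symm
  constructor
  · exact rstep H h.step h.last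
  · rw [r2, r1 0 (by omega)]
    exact (h.step _ le_rfl).symm
  · exact rstep G h.step' h.last'
  · rw [r2, r1 0 (by omega)]
    exact (h.step' _ le_rfl).symm
  · intro i _
    refine h.mixed _ ?_
    unfold reflectIndex
    split_ifs <;> omega
  · intro i hi
    rcases Nat.lt_or_ge i k with h1 | h1
    · rw [r1 i (by omega), r1 _ (by omega)]
      have := h.opposite (2 * k - (i + (k + 1))) (by omega)
      rw [show 2 * k - (i + (k + 1)) + (k + 1) = 2 * k - i by omega] at this
      exact this.symm
    · obtain rfl : i = k := by omega
      rw [r1 i (by omega), show i + (i + 1) = 2 * i + 1 by omega, r2,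
        show 2 * i - i = i by omega]
      have := h.opposite i le_rfl
      rwa [show i + (i + 1) = 2 * i + 1 by omega] at this
  · intro i hi hik
    rw [r1 i (by omega), r1 _ (by omega)]
    have := h.chord (2 * k - (i + k)) (by omega) (by omega)
    rw [show 2 * k - (i + k) + k = 2 * k - i by omega] at this
    exact this.symm

theorem layerColours_even {k : ℕ} (hk : 4 ≤ k) (he : k % 2 = 0) :
    LayerColours k (fun i => Fin.ofNat 3 (evenColour k i.val))
      (fun i => Fin.ofNat 3 (evenColour' k i.val)) := by
  constructor
  · intro i
    rw [fin_three_ne]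
    have := fin_val_succ i
    have := i.isLt
    generalize (i + 1).val = j at *
    generalize i.val = i at *
    unfold evenColour zigzag
    grind (splits := 40)
  · intro i
    rw [fin_three_ne]
    have := fin_val_succ i
    have := i.isLt
    generalize (i + 1).val = j at *
    generalize i.val = i at *
    unfold evenColour' zigzag
    grind (splits := 40)
  · intro i
    rw [fin_three_ne]
    unfold evenColour evenColour'
    grind
  · intro _ i
    rw [fin_three_eq]
    have := fin_val_add_half i
    have := i.isLt
    generalize (i + cyclePoint k (k + 1)).val = j at *
    generalize i.val = i at *
    unfold evenColour'
    grind (splits := 40)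
  · omega

theorem evenColour_add_half {k : ℕ} (i : Fin (2 * k + 2)) (h0 : i.val ≠ 0)
    (h1 : i.val ≠ k + 1) :
    Fin.ofNat 3 (evenColour k i.val) ≠
      Fin.ofNat 3 (evenColour k (i + cyclePoint k (k + 1)).val) := by
  rw [fin_three_ne]
  have := fin_val_add_half i
  have := i.isLt
  generalize (i + cyclePoint k (k + 1)).val = j at *
  generalize i.val = i at *
  unfold evenColour
  grind (splits := 40)

/-- For even k the Möbius ladder L_k is invariant under rotation, so one pattern serves all extra
edges. -/
theorem LayerColours.rotate {k : ℕ} {c g : Fin (2 * k + 2) → Fin 3} (h : LayerColours k c g)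
    (j : Fin (2 * k + 2)) : LayerColours k (fun i => c (i - j)) (fun i => g (i - j)) := by
  refine ⟨fun i => ?_, fun i => ?_, fun i => h.mixed _, fun he i => ?_, fun ho i => ?_⟩
  · rw [add_sub_right_comm]; exact h.step _
  · rw [add_sub_right_comm]; exact h.step' _
  · rw [add_sub_right_comm]; exact h.even he _
  · rw [add_sub_right_comm]; exact h.odd ho _

theorem exists_colouring_even {k : ℕ} (hk : 4 ≤ k) (he : k % 2 = 0) (j : Fin (2 * k + 2)) :
    ∃ f : schrijverVertices (2 * k + 2) k → Fin 3, ∀ A B, (kleinGraph k).Adj A B → f A = f B →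
      s(A, B) = s(bottomVertex k j, bottomVertex k (j + cyclePoint k (k + 1))) := by
  have hl := (layerColours_even hk he).rotate j
  refine hl.exists_colouring_delete (by omega) fun a b hab hc => ?_
  rcases layerGraph_adj.1 hab with hs | ⟨_, hs⟩
  · exact absurd hc (hs.ne_of_step hl.step)
  · rw [if_pos (Nat.even_iff.2 he)] at hs
    have hK : cyclePoint k (k + 1) + cyclePoint k (k + 1) = 0 := by
      rw [← cyclePoint_add, show k + 1 + (k + 1) = 0 + (2 * k + 2) by omega,
        cyclePoint_add_period]
      rfl
    have hab' : b = a + cyclePoint k (k + 1) := by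
      have := fin_val_add_half a
      have := b.isLt
      have := a.isLt
      apply Fin.ext
      omega
    subst hab'
    have hz : (a - j).val = 0 ∨ (a - j).val = k + 1 := by
      by_contra hz
      push Not at hz
      have := evenColour_add_half (a - j) hz.1 hz.2
      rw [← add_sub_right_comm] at this
      exact this hc
    rcases hz with hz | hz
    · have : a - j = 0 := Fin.ext hz
      rw [sub_eq_zero] at this
      rw [this]
    · have : a - j = cyclePoint k (k + 1) :=
        Fin.ext (by rw [hz, cyclePoint_self (by omega)])
      rw [sub_eq_iff_eq_add'] at this
      rw [this, add_assoc, hK, add_zero]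
      exact Sym2.eq_swap

/-! ### Critical edges and the exceptional case k = 3 -/

theorem colorable_deleteEdges {V : Type*} {G : SimpleGraph V} {e : Sym2 V} {n : ℕ} (f : V → Fin n)
    (hf : ∀ A B, G.Adj A B → f A = f B → s(A, B) = e) : (G.deleteEdges {e}).Colorable n :=
  ⟨SimpleGraph.Coloring.mk f fun {A B} hAB he => by
    rw [SimpleGraph.deleteEdges_adj] at hAB
    exact hAB.2 (hf A B hAB.1 he)⟩

theorem isCriticalEdge_of_colouring {k : ℕ} (hk : 2 ≤ k)
    {e : Sym2 (schrijverVertices (2 * k + 2) k)} (he : e ∈ (kleinGraph k).edgeSet)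
    (h : ∃ f : schrijverVertices (2 * k + 2) k → Fin 3,
      ∀ A B, (kleinGraph k).Adj A B → f A = f B → s(A, B) = e) :
    IsCriticalEdge (kleinGraph k) e := by
  obtain ⟨f, hf⟩ := h
  refine ⟨he, ?_⟩
  by_contra hn
  rw [not_lt] at hn
  exact kleinGraph_not_colorable hk (SimpleGraph.chromaticNumber_le_iff_colorable.1
    (hn.trans (SimpleGraph.chromaticNumber_le_iff_colorable.2 (colorable_deleteEdges f hf))))

theorem TokenMove.isCriticalEdge {k : ℕ} (hk : 2 ≤ k) {A B : schrijverVertices (2 * k + 2) k}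
    {p q p' q' : Fin (2 * k + 2)} (h : TokenMove A B p q p' q')
    (hAB : (kleinGraph k).Adj A B) : IsCriticalEdge (kleinGraph k) s(A, B) :=
  isCriticalEdge_of_colouring hk hAB (h.exists_colouring hAB.ne)

/-- For odd `k`, the edges of `Y_k` that are not along token moves are the `k+1` extra edges of the
bottom layer. -/
theorem kleinGraph_cases_odd {k : ℕ} (hk : 2 ≤ k) (ho : k % 2 = 1)
    {e : Sym2 (schrijverVertices (2 * k + 2) k)} (he : e ∈ (kleinGraph k).edgeSet) :
    IsCriticalEdge (kleinGraph k) e ∨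
      ∃ j ≤ k, e = s(bottomVertex k (cyclePoint k j), bottomVertex k (cyclePoint k (j + k))) := by
  induction e using Sym2.ind with
  | _ A B =>
    rcases kleinGraph_cases he with ⟨i, j, rfl, rfl, hij, hs⟩ | ⟨p, q, p', q', h⟩
    · right
      rcases layerGraph_adj.1 hij with h | ⟨_, h⟩
      · exact absurd h hs
      · rw [if_neg (by rw [Nat.not_even_iff_odd]; exact Nat.odd_iff.2 ho)] at h
        rcases h with ⟨h1, h2⟩ | ⟨h1, h2⟩
        · exact ⟨i.val, h1, by rw [← h2, cyclePoint_fin, cyclePoint_fin]⟩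
        · exact ⟨j.val, h1, by rw [← h2, cyclePoint_fin, cyclePoint_fin, Sym2.eq_swap]⟩
    · exact Or.inl (h.isCriticalEdge hk he)

theorem isCriticalEdge_even {k : ℕ} (hk : 4 ≤ k) (he : k % 2 = 0)
    {e : Sym2 (schrijverVertices (2 * k + 2) k)} (h : e ∈ (kleinGraph k).edgeSet) :
    IsCriticalEdge (kleinGraph k) e := by
  induction e using Sym2.ind with
  | _ A B =>
    rcases kleinGraph_cases h with ⟨i, j, rfl, rfl, hij, hs⟩ | ⟨p, q, p', q', h'⟩
    · refine isCriticalEdge_of_colouring (by omega) h ?_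
      rcases layerGraph_adj.1 hij with h' | ⟨_, h'⟩
      · exact absurd h' hs
      · rw [if_pos (Nat.even_iff.2 he)] at h'
        have : j = i + cyclePoint k (k + 1) := by
          have := fin_val_add_half i
          have := j.isLt
          have := i.isLt
          apply Fin.ext
          omega
        rw [this]
        exact exists_colouring_even hk he i
    · exact h'.isCriticalEdge (by omega) h

theorem exists_colouring_end {k : ℕ} (hk : 3 ≤ k) (ho : k % 2 = 1) {j : ℕ}
    (hj : j = 0 ∨ j = k) :
    ∃ f : schrijverVertices (2 * k + 2) k → Fin 3, ∀ A B, (kleinGraph k).Adj A B → f A = f B →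
      s(A, B) = s(bottomVertex k (cyclePoint k j), bottomVertex k (cyclePoint k (j + k))) := by
  rcases hj with rfl | rfl
  · exact (oddSeq_end hk ho).exists_colouring hk ho
  · exact ((oddSeq_end hk ho).reflect hk).exists_colouring hk ho

theorem isCriticalEdge_odd {k : ℕ} (hk : 5 ≤ k) (ho : k % 2 = 1)
    {e : Sym2 (schrijverVertices (2 * k + 2) k)} (h : e ∈ (kleinGraph k).edgeSet) :
    IsCriticalEdge (kleinGraph k) e := by
  rcases kleinGraph_cases_odd (by omega) ho h with h' | ⟨j, hj, rfl⟩
  · exact h'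
  · refine isCriticalEdge_of_colouring (by omega) h ?_
    by_cases h0 : j = 0 ∨ j = k
    · exact exists_colouring_end (by omega) ho h0
    · exact (oddSeq_inner hk ho (by omega) (by omega)).exists_colouring (by omega) ho

/-- Non-criticality needs an upper bound on the chromatic number. The fourth colour goes to one end
of a critical extra edge. -/
theorem kleinGraph_three_colorable : (kleinGraph 3).Colorable 4 := by
  classical
  obtain ⟨f, hf⟩ := exists_colouring_end (k := 3) le_rfl rfl (j := 0) (Or.inl rfl)
  refine ⟨SimpleGraph.Coloring.mk
    (fun A => if A = bottomVertex 3 (cyclePoint 3 0) then 3 else (f A).castSucc) ?_⟩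
  intro A B hAB he
  have h3 : ∀ x : Fin 3, x.castSucc ≠ 3 := by decide
  split_ifs at he with h1 h2 h2
  · exact hAB.ne (h1.trans h2.symm)
  · exact h3 _ he.symm
  · exact h3 _ he
  · have := hf A B hAB (Fin.castSucc_injective _ he)
    rw [Sym2.eq_iff] at this
    rcases this with h | h
    · exact h1 h.1
    · exact h2 h.2

theorem not_isCriticalEdge_three {j : ℕ} (hj : j = 1 ∨ j = 2) :
    ¬ IsCriticalEdge (kleinGraph 3)
      s(bottomVertex 3 (cyclePoint 3 j), bottomVertex 3 (cyclePoint 3 (j + 3))) := by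
  rintro ⟨_, hlt⟩
  have h1 := hlt.trans_le
    (SimpleGraph.chromaticNumber_le_iff_colorable.2 kleinGraph_three_colorable)
  have h2 : ((kleinGraph 3).deleteEdges
      {s(bottomVertex 3 (cyclePoint 3 j), bottomVertex 3 (cyclePoint 3 (j + 3)))}).Colorable 3 := by
    rw [← SimpleGraph.chromaticNumber_le_iff_colorable]
    exact Order.le_of_lt_add_one (by exact_mod_cast h1)
  obtain ⟨C⟩ := h2
  have hinj := bottomVertex_injective (k := 3) (by omega)
  have hedge : ∀ A B, (kleinGraph 3).Adj A B → C A = C B →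
      s(A, B) = s(bottomVertex 3 (cyclePoint 3 j), bottomVertex 3 (cyclePoint 3 (j + 3))) := by
    intro A B hAB he
    by_contra hne
    exact C.valid (SimpleGraph.deleteEdges_adj.2 ⟨hAB, hne⟩) he
  have hchord : ∀ a b : Fin 8, (layerGraph 3).Adj a b →
      s(a, b) ≠ s(cyclePoint 3 j, cyclePoint 3 (j + 3)) →
      C (bottomVertex 3 a) ≠ C (bottomVertex 3 b) := by
    intro a b hab hne he
    have := hedge _ _ ((kleinGraph_adj_bottomVertex (by omega)).2 hab) he
    exact hne (Sym2.map.injective hinj this)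
  -- Neither {0,3} nor {3,6} is the deleted edge, and the deleted edge is not a token move, so every
  -- constraint of the obstruction survives.
  refine no_colouring_three (c := C) (fun A B p q p' q' h hne he => ?_)
    (hchord 0 3 ?_ ?_) (hchord 3 6 ?_ ?_)
  · have h3 := hedge A B (h.adj_klein (by omega) hne) he
    have hj' : ¬ TokenStep (cyclePoint 3 j) (cyclePoint 3 (j + 3)) := by
      unfold TokenStep
      rcases hj with rfl | rfl <;> decide
    have hne' : cyclePoint 3 j ≠ cyclePoint 3 (j + 3) := by
      rcases hj with rfl | rfl <;> decide
    rw [Sym2.eq_iff] at h3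
    rcases h3 with ⟨rfl, rfl⟩ | ⟨rfl, rfl⟩
    · exact hj' (tokenStep_of_tokenMove_bottom (by omega) h hne')
    · exact hj' (tokenStep_of_tokenMove_bottom (by omega) h hne'.symm).symm
  · exact layerGraph_adj.2 (Or.inr ⟨by decide, Or.inl ⟨by decide, rfl⟩⟩)
  · rcases hj with rfl | rfl <;> decide
  · exact layerGraph_adj.2 (Or.inr ⟨by decide, Or.inl ⟨by decide, rfl⟩⟩)
  · rcases hj with rfl | rfl <;> decide

theorem mainTheorem6 :
    (∀ k : ℕ, 4 ≤ k → IsEdgeColorCritical (kleinGraph k)) ∧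
      {e ∈ (kleinGraph 3).edgeSet | ¬ IsCriticalEdge (kleinGraph 3) e}.ncard = 2 := by
  refine ⟨fun k hk e he => ?_, ?_⟩
  · rcases Nat.mod_two_eq_zero_or_one k with h | h
    · exact isCriticalEdge_even hk h he
    · exact isCriticalEdge_odd (by omega) h he
  · have hset : {e ∈ (kleinGraph 3).edgeSet | ¬ IsCriticalEdge (kleinGraph 3) e} =
        {s(bottomVertex 3 (cyclePoint 3 1), bottomVertex 3 (cyclePoint 3 (1 + 3))),
          s(bottomVertex 3 (cyclePoint 3 2), bottomVertex 3 (cyclePoint 3 (2 + 3)))} := by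
      ext e
      rw [Set.mem_insert_iff, Set.mem_singleton_iff]
      constructor
      · rintro ⟨he, hn⟩
        rcases kleinGraph_cases_odd (by omega) rfl he with h | ⟨j, hj, rfl⟩
        · exact absurd h hn
        · by_cases h0 : j = 0 ∨ j = 3
          · exact absurd (isCriticalEdge_of_colouring (by omega) he
              (exists_colouring_end le_rfl rfl h0)) hn
          · obtain rfl | rfl : j = 1 ∨ j = 2 := by omega
            · exact Or.inl rfl
            · exact Or.inr rfl
      · have hadj : ∀ a b : Fin 8, a ≠ b → a.val ≤ 3 → b.val = a.val + 3 →
            (kleinGraph 3).Adj (bottomVertex 3 a) (bottomVertex 3 b) := fun a b h1 h2 h3 =>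
          (kleinGraph_adj_bottomVertex (by omega)).2
            (layerGraph_adj.2 (Or.inr ⟨h1, Or.inl ⟨h2, h3⟩⟩))
        rintro (rfl | rfl)
        · exact ⟨hadj _ _ (by decide) (by decide) rfl, not_isCriticalEdge_three (Or.inl rfl)⟩
        · exact ⟨hadj _ _ (by decide) (by decide) rfl, not_isCriticalEdge_three (Or.inr rfl)⟩
    rw [hset]
    refine Set.ncard_pair fun h => ?_
    have h' : s(cyclePoint 3 1, cyclePoint 3 (1 + 3)) = s(cyclePoint 3 2, cyclePoint 3 (2 + 3)) :=
      Sym2.map.injective (bottomVertex_injective (k := 3) (by omega)) h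
    exact absurd h' (by decide)
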